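/- Let $\mathbb{K}$ be a field and let $q\in\mathbb{K}^\times$ be not a root of unity. Let $U=U_q(\mathfrak{sl}_2)$ be the $\mathbb{K}$-algebra with generators $E,F,K,K^{-1}$ and relations $KK^{-1}=K^{-1}K=1$, $KE=q^2EK$, $KF=q^{-2}FK$, $[E,F]=\frac{K-K^{-1}}{q-q^{-1}}$, with coproduct $\Delta(E)=E\otimes 1+K\otimes E$, $\Delta(F)=F\otimes K^{-1}+1\otimes F$, $\Delta(K^{\pm1})=K^{\pm1}\otimes K^{\pm1}$ and Casimir element $\Lambda=(q-q^{-1})^2EF+q^{-1}K+qK^{-1}$. Let $\mathcal{I}_R\subseteq U$ be the subalgebra generated by $EK^{-1},F,K^{-1},\Lambda$ (it satisfies $\Delta(\mathcal{I}_R)\subseteq U\otimes\mathcal{I}_R$), and let $\tau_R\colon\mathcal{I}_R\to U\otimes\mathcal{I}_R$ be the algebra morphism with $$\tau_R(EK^{-1})=K^{-1}\otimes EK^{-1},\qquad \tau_R(\Lambda)=1\otimes\Lambda,\qquad \tau_R(K^{-1})=1\otimes K^{-1}-q^{-1}(q-q^{-1})^2F\otimes EK^{-1},$$ $$\tau_R(F)=K\otimes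 F-q^{-3}(q-q^{-1})^2F^2K\otimes EK^{-1}+q^{-1}(q+q^{-1})FK\otimes K^{-1}-q^{-1}FK\otimes\Lambda.$$ For $n\in\mathbb{N}$ and $A\subseteq\{1,\dots,n\}$ define $\Lambda_A\in U^{\otimes n}$ as follows. Put $\Lambda_\varnothing=q+q^{-1}$. If $A\neq\varnothing$ has minimum $a$ and maximum $b$, put $X_0=\Lambda$ and, for $0\le s<b-a$, $X_{s+1}=(1^{\otimes s}\otimes\varphi_s)(X_s)\in U^{\otimes(s+1)}\otimes\mathcal{I}_R$, where $\varphi_s=\Delta$ if $a+s\in A$ and $\varphi_s=\tau_R$ if $a+s\notin A$; then $\Lambda_A=1^{\otimes(a-1)}\otimes X_{b-a}\otimes 1^{\otimes(n-b)}$. Write $[X,Y]_q=qXY-q^{-1}YX$. **Proposition.** For all $k,\ell\in\mathbb{N}=\{0,1,2,\dots\}$ (where $\{2,4,\dots,2k\}=\varnothing$ for $k=0$) and for every $n$ with $A\cup B\subseteq\{1,\dots,n\}$, the relation $$[\Lambda_A,\Lambda_B]_q=(q^{-2}-q^2)\Lambda_{(A\cup B)\setminus(A\cap B)}+(q-q^{-1})\big(\Lambda_{A\cap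 B}\Lambda_{A\cup B}+\Lambda_{A\setminus(A\cap B)}\Lambda_{B\setminus(A\cap B)}\big)\qquad(\ast)$$ holds in $U^{\otimes n}$ for each of the following nine pairs $(A,B)$: - (C1) $A=\{1,2,4,6,\dots,2k\}$, $B=\{2,4,6,\dots,2k,2k+1\}$; - (C2) $A=\{2,4,6,\dots,2k,2k+1\}$, $B=\{1,2k+1\}$; - (C3) $A=\{1,2k+1\}$, $B=\{1,2,4,6,\dots,2k\}$; - (C4) $A=\{1,2,4,6,\dots,2k,2k+2\ell+2\}$, $B=\{2,4,6,\dots,2k,2k+1,2k+3,\dots,2k+2\ell+1\}$; - (C4′) $A=\{1,2,4,6,\dots,2k,2k+2\ell+3\}$, $B=\{2,4,6,\dots,2k,2k+2,2k+4,\dots,2k+2\ell+2\}$; - (C5) $A=\{2,4,6,\dots,2k,2k+1,2k+3,\dots,2k+2\ell+1\}$, $B=\{1,2k+1,2k+3,\dots,2k+2\ell+1,2k+2\ell+2\}$; - (C5′) $A=\{2,4,6,\dots,2k,2k+2,2k+4,\dots,2k+2\ell+2\}$, $B=\{1,2k+2,2k+4,\dots,2k+2\ell+2,2k+2\ell+3\}$;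 - (C6) $A=\{1,2k+1,2k+3,\dots,2k+2\ell+1,2k+2\ell+2\}$, $B=\{1,2,4,6,\dots,2k,2k+2\ell+2\}$; - (C6′) $A=\{1,2k+2,2k+4,\dots,2k+2\ell+2,2k+2\ell+3\}$, $B=\{1,2,4,6,\dots,2k,2k+2\ell+3\}$. -/

import Mathlib

open scoped TensorProduct

noncomputable section

namespace AskeyWilson

universe u

/-! ### The quantum group and its coproduct -/

/-- Names of the generators `E`, `F`, `K`, `K⁻¹`. -/
inductive Gen
  | E | F | K | Kinv

/-- The defining relations of `U_q(sl₂)`. -/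
inductive Rel {𝕜 : Type u} [Field 𝕜] (q : 𝕜ˣ) :
    FreeAlgebra 𝕜 Gen → FreeAlgebra 𝕜 Gen → Prop
  | K_Kinv : Rel q (FreeAlgebra.ι 𝕜 Gen.K * FreeAlgebra.ι 𝕜 Gen.Kinv) 1
  | Kinv_K : Rel q (FreeAlgebra.ι 𝕜 Gen.Kinv * FreeAlgebra.ι 𝕜 Gen.K) 1
  | K_E : Rel q (FreeAlgebra.ι 𝕜 Gen.K * FreeAlgebra.ι 𝕜 Gen.E)
      ((q : 𝕜) ^ 2 • (FreeAlgebra.ι 𝕜 Gen.E * FreeAlgebra.ι 𝕜 Gen.K))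
  | K_F : Rel q (FreeAlgebra.ι 𝕜 Gen.K * FreeAlgebra.ι 𝕜 Gen.F)
      ((q : 𝕜)⁻¹ ^ 2 • (FreeAlgebra.ι 𝕜 Gen.F * FreeAlgebra.ι 𝕜 Gen.K))
  | E_F : Rel q (FreeAlgebra.ι 𝕜 Gen.E * FreeAlgebra.ι 𝕜 Gen.F -
        FreeAlgebra.ι 𝕜 Gen.F * FreeAlgebra.ι 𝕜 Gen.E)
      (((q : 𝕜) - (q : 𝕜)⁻¹)⁻¹ • (FreeAlgebra.ι 𝕜 Gen.K - FreeAlgebra.ι 𝕜 Gen.Kinv))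

/-- The algebra `U_q(sl₂)` over the field `𝕜`. -/
def Uq {𝕜 : Type u} [Field 𝕜] (q : 𝕜ˣ) : Type u := RingQuot (Rel q)

/-- The parameter `q` is not a root of unity. -/
def NotRootOfUnity {𝕜 : Type u} [Field 𝕜] (q : 𝕜ˣ) : Prop := ∀ m : ℕ, 0 < m → q ^ m ≠ 1

section

variable {𝕜 : Type u} [Field 𝕜] (q : 𝕜ˣ)

instance : Ring (Uq q) := inferInstanceAs (Ring (RingQuot (Rel q)))

instance : Algebra 𝕜 (Uq q) := inferInstanceAs (Algebra 𝕜 (RingQuot (Rel q)))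

/-- The quotient map from the free algebra. -/
def Uq.mk : FreeAlgebra 𝕜 Gen →ₐ[𝕜] Uq q := RingQuot.mkAlgHom 𝕜 (Rel q)

theorem Uq.mk_rel {x y : FreeAlgebra 𝕜 Gen} (h : Rel q x y) : Uq.mk q x = Uq.mk q y :=
  RingQuot.mkAlgHom_rel 𝕜 h

/-- The generator `E`. -/
def genE : Uq q := Uq.mk q (FreeAlgebra.ι 𝕜 Gen.E)

/-- The generator `F`. -/
def genF : Uq q := Uq.mk q (FreeAlgebra.ι 𝕜 Gen.F)

/-- The generator `K`. -/
def genK : Uq q := Uq.mk q (FreeAlgebra.ι 𝕜 Gen.K)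

/-- The generator `K⁻¹`. -/
def genKinv : Uq q := Uq.mk q (FreeAlgebra.ι 𝕜 Gen.Kinv)

theorem K_mul_Kinv : genK q * genKinv q = 1 := by
  have h := Uq.mk_rel q Rel.K_Kinv
  simp only [map_mul, map_one] at h
  exact h

theorem Kinv_mul_K : genKinv q * genK q = 1 := by
  have h := Uq.mk_rel q Rel.Kinv_K
  simp only [map_mul, map_one] at h
  exact h

theorem K_mul_E : genK q * genE q = (q : 𝕜) ^ 2 • (genE q * genK q) := by
  have h := Uq.mk_rel q Rel.K_E
  simp only [map_mul, map_smul] at h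
  exact h

theorem K_mul_F : genK q * genF q = (q : 𝕜)⁻¹ ^ 2 • (genF q * genK q) := by
  have h := Uq.mk_rel q Rel.K_F
  simp only [map_mul, map_smul] at h
  exact h

theorem E_mul_F : genE q * genF q =
    genF q * genE q + ((q : 𝕜) - (q : 𝕜)⁻¹)⁻¹ • (genK q - genKinv q) := by
  rw [← sub_eq_iff_eq_add']
  have h := Uq.mk_rel q Rel.E_F
  simp only [map_mul, map_smul, map_sub] at h
  exact h

theorem Kinv_mul_F : genKinv q * genF q = (q : 𝕜) ^ 2 • (genF q * genKinv q) := by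
  have h : genKinv q * (genK q * genF q) * genKinv q =
      genKinv q * ((q : 𝕜)⁻¹ ^ 2 • (genF q * genK q)) * genKinv q := by rw [K_mul_F]
  rw [← mul_assoc, Kinv_mul_K, one_mul, mul_smul_comm, smul_mul_assoc, mul_assoc, mul_assoc,
    K_mul_Kinv, mul_one] at h
  rw [h, smul_smul, ← mul_pow, mul_inv_cancel₀ q.ne_zero, one_pow, one_smul]

theorem E_mul_Kinv : genE q * genKinv q = (q : 𝕜) ^ 2 • (genKinv q * genE q) := by
  have h : genKinv q * (genK q * genE q) * genKinv q =
      genKinv q * ((q : 𝕜) ^ 2 • (genE q * genK q)) * genKinv q := by rw [K_mul_E]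
  rw [← mul_assoc, Kinv_mul_K, one_mul, mul_smul_comm, smul_mul_assoc, mul_assoc, mul_assoc,
    K_mul_Kinv, mul_one] at h
  exact h

theorem E_mul_K : genE q * genK q = (q : 𝕜)⁻¹ ^ 2 • (genK q * genE q) := by
  rw [K_mul_E, smul_smul, ← mul_pow, inv_mul_cancel₀ q.ne_zero, one_pow, one_smul]

variable {A : Type*} [Ring A] [Algebra 𝕜 A]

/-- The algebra morphism out of `U_q(sl₂)` with prescribed values on the generators. -/
def Uq.lift (e f k k' : A) (h1 : k * k' = 1) (h2 : k' * k = 1)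
    (h3 : k * e = (q : 𝕜) ^ 2 • (e * k)) (h4 : k * f = (q : 𝕜)⁻¹ ^ 2 • (f * k))
    (h5 : e * f - f * e = ((q : 𝕜) - (q : 𝕜)⁻¹)⁻¹ • (k - k')) : Uq q →ₐ[𝕜] A :=
  RingQuot.liftAlgHom 𝕜 ⟨FreeAlgebra.lift 𝕜 (fun g => match g with
    | .E => e | .F => f | .K => k | .Kinv => k'), by
    rintro x y (_ | _ | _ | _ | _) <;> simp [h1, h2, h3, h4, h5]⟩

section lift

variable (e f k k' : A) (h1 h2 h3 h4 h5)

theorem Uq.lift_genE : Uq.lift q e f k k' h1 h2 h3 h4 h5 (genE q) = e :=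
  (RingQuot.liftAlgHom_mkAlgHom_apply _ _ _ _).trans (by simp)

theorem Uq.lift_genF : Uq.lift q e f k k' h1 h2 h3 h4 h5 (genF q) = f :=
  (RingQuot.liftAlgHom_mkAlgHom_apply _ _ _ _).trans (by simp)

theorem Uq.lift_genK : Uq.lift q e f k k' h1 h2 h3 h4 h5 (genK q) = k :=
  (RingQuot.liftAlgHom_mkAlgHom_apply _ _ _ _).trans (by simp)

theorem Uq.lift_genKinv : Uq.lift q e f k k' h1 h2 h3 h4 h5 (genKinv q) = k' :=
  (RingQuot.liftAlgHom_mkAlgHom_apply _ _ _ _).trans (by simp)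

end lift

/-- The coproduct `Δ : U → U ⊗ U`. -/
def coprod : Uq q →ₐ[𝕜] Uq q ⊗[𝕜] Uq q :=
  Uq.lift q
    (genE q ⊗ₜ 1 + genK q ⊗ₜ genE q)
    (genF q ⊗ₜ genKinv q + 1 ⊗ₜ genF q)
    (genK q ⊗ₜ genK q)
    (genKinv q ⊗ₜ genKinv q)
    (by simp [K_mul_Kinv, Algebra.TensorProduct.one_def])
    (by simp [Kinv_mul_K, Algebra.TensorProduct.one_def])
    (by simp [mul_add, add_mul, K_mul_E, TensorProduct.smul_tmul'])
    (by
      simp [mul_add, add_mul, K_mul_F, K_mul_Kinv, Kinv_mul_K, TensorProduct.smul_tmul'])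
    (by
      have hq : (q : 𝕜) ≠ 0 := q.ne_zero
      simp only [mul_add, add_mul, Algebra.TensorProduct.tmul_mul_tmul, one_mul, mul_one,
        K_mul_F, E_mul_Kinv, E_mul_F, TensorProduct.tmul_add, TensorProduct.add_tmul,
        TensorProduct.tmul_smul, ← TensorProduct.smul_tmul', TensorProduct.tmul_sub,
        TensorProduct.sub_tmul, smul_sub, smul_smul]
      match_scalars <;> field_simp <;> ring)

theorem coprod_genE : coprod q (genE q) = genE q ⊗ₜ 1 + genK q ⊗ₜ genE q := Uq.lift_genE ..

theorem coprod_genF : coprod q (genF q) = genF q ⊗ₜ genKinv q + 1 ⊗ₜ genF q := Uq.lift_genF ..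

theorem coprod_genK : coprod q (genK q) = genK q ⊗ₜ genK q := Uq.lift_genK ..

theorem coprod_genKinv : coprod q (genKinv q) = genKinv q ⊗ₜ genKinv q := Uq.lift_genKinv ..

/-- The Casimir element `Λ = (q - q⁻¹)² E F + q⁻¹ K + q K⁻¹`. -/
def casimir : Uq q :=
  ((q : 𝕜) - (q : 𝕜)⁻¹) ^ 2 • (genE q * genF q) + (q : 𝕜)⁻¹ • genK q + (q : 𝕜) • genKinv q

/-! ### The left coideal subalgebra and its two maps into `U ⊗ I_R` -/

/-- The subalgebra `I_R` of `U_q(sl₂)` generated by `E K⁻¹`, `F`, `K⁻¹` and `Λ`. -/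
def IR : Subalgebra 𝕜 (Uq q) :=
  Algebra.adjoin 𝕜 {genE q * genKinv q, genF q, genKinv q, casimir q}

/-- `E K⁻¹` as an element of `I_R`. -/
def irE : IR q := ⟨genE q * genKinv q, Algebra.subset_adjoin (by simp)⟩

/-- `F` as an element of `I_R`. -/
def irF : IR q := ⟨genF q, Algebra.subset_adjoin (by simp)⟩

/-- `K⁻¹` as an element of `I_R`. -/
def irKinv : IR q := ⟨genKinv q, Algebra.subset_adjoin (by simp)⟩

/-- `Λ` as an element of `I_R`. -/
def irCas : IR q := ⟨casimir q, Algebra.subset_adjoin (by simp)⟩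

/-- The inclusion of `U ⊗ I_R` in `U ⊗ U`. -/
def inclR : Uq q ⊗[𝕜] IR q →ₐ[𝕜] Uq q ⊗[𝕜] Uq q :=
  Algebra.TensorProduct.map (AlgHom.id 𝕜 (Uq q)) (IR q).val

theorem inclR_tmul (x : Uq q) (y : IR q) : inclR q (x ⊗ₜ y) = x ⊗ₜ (y : Uq q) := rfl

theorem inclR_injective : Function.Injective (inclR q) :=
  Module.Flat.lTensor_preserves_injective_linearMap (M := Uq q) (IR q).val.toLinearMap
    Subtype.val_injective

theorem IR_hom_ext {φ ψ : IR q →ₐ[𝕜] A} (h1 : φ (irE q) = ψ (irE q)) (h2 : φ (irF q) = ψ (irF q))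
    (h3 : φ (irKinv q) = ψ (irKinv q)) (h4 : φ (irCas q) = ψ (irCas q)) : φ = ψ := by
  refine AlgHom.ext_of_adjoin_eq_top (Algebra.adjoin_adjoin_coe_preimage
    (s := {genE q * genKinv q, genF q, genKinv q, casimir q})) ?_
  rintro ⟨x, hx⟩ h
  simp only [Set.mem_preimage, Set.mem_insert_iff, Set.mem_singleton_iff] at h
  obtain rfl | rfl | rfl | rfl := h
  exacts [h1, h2, h3, h4]

/-- A morphism defined on `I_R` takes values in a subalgebra as soon as the generators do. -/
theorem IR_range_le (φ : IR q →ₐ[𝕜] A) (S : Subalgebra 𝕜 A) (h1 : φ (irE q) ∈ S)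
    (h2 : φ (irF q) ∈ S) (h3 : φ (irKinv q) ∈ S) (h4 : φ (irCas q) ∈ S) (x : IR q) : φ x ∈ S := by
  have h : (Algebra.adjoin 𝕜 (((↑) : IR q → Uq q) ⁻¹'
      {genE q * genKinv q, genF q, genKinv q, casimir q})) ≤ S.comap φ := by
    rw [Algebra.adjoin_le_iff]
    rintro ⟨x, hx⟩ h
    simp only [Set.mem_preimage, Set.mem_insert_iff, Set.mem_singleton_iff] at h
    obtain rfl | rfl | rfl | rfl := h
    exacts [h1, h2, h3, h4]
  have h' := h.trans' (Algebra.adjoin_adjoin_coe_preimage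
    (s := {genE q * genKinv q, genF q, genKinv q, casimir q})).ge
  exact h' (Algebra.mem_top (x := x))

/-- Lifting a morphism defined on `I_R` along an injective morphism. -/
theorem IR_exists_lift {B : Type*} [Ring B] [Algebra 𝕜 B] (j : B →ₐ[𝕜] A)
    (hj : Function.Injective j) (φ : IR q →ₐ[𝕜] A) (e f k l : B) (h1 : φ (irE q) = j e)
    (h2 : φ (irF q) = j f) (h3 : φ (irKinv q) = j k) (h4 : φ (irCas q) = j l) :
    ∃ ψ : IR q →ₐ[𝕜] B, j.comp ψ = φ ∧
      ψ (irE q) = e ∧ ψ (irF q) = f ∧ ψ (irKinv q) = k ∧ ψ (irCas q) = l := by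
  have h := IR_range_le q φ j.range (h1 ▸ ⟨e, rfl⟩) (h2 ▸ ⟨f, rfl⟩) (h3 ▸ ⟨k, rfl⟩)
    (h4 ▸ ⟨l, rfl⟩)
  have key : j.comp (((AlgEquiv.ofInjective j hj).symm : j.range →ₐ[𝕜] B).comp
      (φ.codRestrict j.range h)) = φ := by
    ext x
    have := (AlgEquiv.ofInjective j hj).apply_symm_apply (φ.codRestrict j.range h x)
    exact congrArg Subtype.val this
  refine ⟨_, key, ?_, ?_, ?_, ?_⟩ <;> apply hj
  · rw [← h1]; exact DFunLike.congr_fun key _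
  · rw [← h2]; exact DFunLike.congr_fun key _
  · rw [← h3]; exact DFunLike.congr_fun key _
  · rw [← h4]; exact DFunLike.congr_fun key _

theorem coprod_casimir : coprod q (casimir q) =
    casimir q ⊗ₜ genKinv q + genK q ⊗ₜ casimir q
      - ((q : 𝕜) + (q : 𝕜)⁻¹) • (genK q ⊗ₜ genKinv q)
      + ((q : 𝕜) - (q : 𝕜)⁻¹) ^ 2 • (genE q ⊗ₜ genF q
        + (q : 𝕜)⁻¹ ^ 2 • ((genF q * genK q) ⊗ₜ (genE q * genKinv q))) := by
  simp only [casimir, map_add, map_smul, map_mul, coprod_genE, coprod_genF, coprod_genK,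
    coprod_genKinv, mul_add, add_mul, Algebra.TensorProduct.tmul_mul_tmul, one_mul, mul_one,
    K_mul_F, TensorProduct.tmul_add, TensorProduct.add_tmul, TensorProduct.tmul_smul,
    ← TensorProduct.smul_tmul', smul_add, smul_smul]
  module

/-- The left coideal property `Δ(I_R) ⊆ U ⊗ I_R`: the coproduct restricts uniquely to a morphism
`I_R → U ⊗ I_R`. -/
theorem existsUnique_coprodR : ∃! δ : IR q →ₐ[𝕜] Uq q ⊗[𝕜] IR q,
    ∀ x : IR q, inclR q (δ x) = coprod q (x : Uq q) := by
  obtain ⟨δ, h, -⟩ := IR_exists_lift q (inclR q) (inclR_injective q)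
    ((coprod q).comp (IR q).val)
    ((genE q * genKinv q) ⊗ₜ irKinv q + 1 ⊗ₜ irE q)
    (genF q ⊗ₜ irKinv q + 1 ⊗ₜ irF q)
    (genKinv q ⊗ₜ irKinv q)
    (casimir q ⊗ₜ irKinv q + genK q ⊗ₜ irCas q
      - ((q : 𝕜) + (q : 𝕜)⁻¹) • (genK q ⊗ₜ irKinv q)
      + ((q : 𝕜) - (q : 𝕜)⁻¹) ^ 2 • (genE q ⊗ₜ irF q
        + (q : 𝕜)⁻¹ ^ 2 • ((genF q * genK q) ⊗ₜ irE q)))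
    (by
      simp [irE, inclR_tmul, irKinv, coprod_genE, coprod_genKinv, add_mul, K_mul_Kinv])
    (by simp [irF, inclR_tmul, irKinv, coprod_genF])
    (by simp [inclR_tmul, irKinv, coprod_genKinv])
    (by simp [inclR_tmul, irKinv, irE, irF, irCas, coprod_casimir])
  refine ⟨δ, fun x => DFunLike.congr_fun h x, fun δ' h' => ?_⟩
  ext x
  apply inclR_injective q
  rw [h']
  exact (DFunLike.congr_fun h x).symm

/-- The restriction `Δ : I_R → U ⊗ I_R` of the coproduct. -/
def coprodR : IR q →ₐ[𝕜] Uq q ⊗[𝕜] IR q := (existsUnique_coprodR q).choose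

set_option linter.unusedSimpArgs false in
/-- The values prescribed for the coaction satisfy the relations of `E K⁻¹`, `F`, `K⁻¹`, `Λ`.
Here `F`, `K`, `k` stand for `F ⊗ 1`, `K ⊗ 1`, `K⁻¹ ⊗ 1` and `e`, `f`, `κ`, `l` for
`1 ⊗ E K⁻¹`, `1 ⊗ F`, `1 ⊗ K⁻¹`, `1 ⊗ Λ`. -/
theorem twist_relations {q : 𝕜} (hq : q ≠ 0) (hs : q - q⁻¹ ≠ 0)
    {W : Type*} [Ring W] [Algebra 𝕜 W] (F K k e f κ l : W)
    (hKk : K * k = 1) (hkK : k * K = 1) (hKF : K * F = q⁻¹ ^ 2 • (F * K))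
    (heF : e * F = F * e) (heK : e * K = K * e) (hek : e * k = k * e)
    (hfF : f * F = F * f) (hfK : f * K = K * f) (hfk : f * k = k * f)
    (hκF : κ * F = F * κ) (hκK : κ * K = K * κ) (hκk : κ * k = k * κ)
    (hlF : l * F = F * l) (hlK : l * K = K * l) (hlk : l * k = k * l)
    (hle : l * e = e * l) (hlf : l * f = f * l) (hlκ : l * κ = κ * l)
    (hκe : κ * e = q⁻¹ ^ 2 • (e * κ)) (hκf : κ * f = q ^ 2 • (f * κ))
    (hef : (q - q⁻¹) ^ 2 • (e * f) = q ^ 2 • (l * κ) - q • 1 - q ^ 3 • (κ * κ))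
    (hfe : (q - q⁻¹) ^ 2 • (f * e) = l * κ - q • 1 - q⁻¹ • (κ * κ))
    {e' f' κ' : W} (he' : e' = k * e)
    (hκ' : κ' = κ - (q⁻¹ * (q - q⁻¹) ^ 2) • (F * e))
    (hf' : f' = K * f - (q⁻¹ ^ 3 * (q - q⁻¹) ^ 2) • (F ^ 2 * K * e)
      + (q⁻¹ * (q + q⁻¹)) • (F * K * κ) - q⁻¹ • (F * K * l)) :
    κ' * e' = q⁻¹ ^ 2 • (e' * κ') ∧ κ' * f' = q ^ 2 • (f' * κ') ∧
    (q - q⁻¹) ^ 2 • (e' * f') = q ^ 2 • (l * κ') - q • 1 - q ^ 3 • (κ' * κ') ∧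
    (q - q⁻¹) ^ 2 • (f' * e') = l * κ' - q • 1 - q⁻¹ • (κ' * κ') := by
  have hkF : k * F = q ^ 2 • (F * k) := by
    have : k * (K * F) * k = k * (q⁻¹ ^ 2 • (F * K)) * k := by rw [hKF]
    rw [← mul_assoc, hkK, one_mul, mul_smul_comm, smul_mul_assoc, mul_assoc, mul_assoc, hKk,
      mul_one] at this
    rw [this, smul_smul, ← mul_pow, mul_inv_cancel₀ hq, one_pow, one_smul]
  have hef' : e * f = ((q - q⁻¹) ^ 2)⁻¹ • (q ^ 2 • (κ * l) - q • 1 - q ^ 3 • (κ * κ)) := by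
    rw [← hlκ, ← hef, smul_smul, inv_mul_cancel₀ (pow_ne_zero 2 hs), one_smul]
  have hfe' : f * e = ((q - q⁻¹) ^ 2)⁻¹ • (κ * l - q • 1 - q⁻¹ • (κ * κ)) := by
    rw [← hlκ, ← hfe, smul_smul, inv_mul_cancel₀ (pow_ne_zero 2 hs), one_smul]
  have asc : ∀ {x y z : W}, x * y = z → ∀ w, x * (y * w) = z * w := by
    intro x y z h w; rw [← mul_assoc, h]
  have aKk := asc hKk
  have akK := asc hkK
  have aKF := asc hKF
  have akF := asc hkF
  have aeF := asc heF
  have aeK := asc heK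
  have aek := asc hek
  have afF := asc hfF
  have afK := asc hfK
  have afk := asc hfk
  have aκF := asc hκF
  have aκK := asc hκK
  have aκk := asc hκk
  have alF := asc hlF
  have alK := asc hlK
  have alk := asc hlk
  have ale := asc hle
  have alf := asc hlf
  have alκ := asc hlκ
  have aκe := asc hκe
  have aκf := asc hκf
  have aef := asc hef'
  have afe := asc hfe'
  have hs' : q ^ 2 - 1 ≠ 0 := by
    intro h
    apply hs
    have h' : q - q⁻¹ = (q ^ 2 - 1) / q := by field_simp
    rw [h', h, zero_div]
  subst he' hκ' hf'
  clear hef hfe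
  refine ⟨?_, ?_, ?_, ?_⟩ <;>
  · simp only [mul_add, add_mul, mul_sub, sub_mul, smul_mul_assoc, mul_smul_comm, mul_assoc, pow_two F,
      smul_add, smul_sub, smul_smul, one_mul, mul_one,
      hKk, hkK, hKF, heF, heK, hek, hfF, hfK, hfk, hκF, hκK, hκk, hlF, hlK, hlk, hle, hlf, hlκ,
      hκe, hκf, hkF, hef', hfe', aKk, akK, aKF, akF, aeF, aeK, aek, afF, afK, afk, aκF, aκK, aκk,
      alF, alK, alk, ale, alf, alκ, aκe, aκf, aef, afe]
    match_scalars <;> field_simp <;> ring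
theorem coprodR_spec (x : IR q) : inclR q (coprodR q x) = coprod q (x : Uq q) :=
  (existsUnique_coprodR q).choose_spec.1 x

section relations

set_option linter.unusedSimpArgs false in
theorem casimir_rel (hs : (q : 𝕜) - (q : 𝕜)⁻¹ ≠ 0) :
    casimir q * genE q = genE q * casimir q ∧ casimir q * genF q = genF q * casimir q ∧
    casimir q * genKinv q = genKinv q * casimir q ∧
    genKinv q * (genE q * genKinv q) = (q : 𝕜)⁻¹ ^ 2 • (genE q * genKinv q * genKinv q) := by
  have hq : (q : 𝕜) ≠ 0 := q.ne_zero
  have hs' : (q : 𝕜) ^ 2 - 1 ≠ 0 := by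
    intro h
    apply hs
    have h' : (q : 𝕜) - (q : 𝕜)⁻¹ = ((q : 𝕜) ^ 2 - 1) / q := by field_simp
    rw [h', h, zero_div]
  have asc : ∀ {x y z : Uq q}, x * y = z → ∀ w, x * (y * w) = z * w := by
    intro x y z h w; rw [← mul_assoc, h]
  refine ⟨?_, ?_, ?_, ?_⟩ <;>
  · simp only [casimir, mul_add, add_mul, mul_sub, sub_mul, smul_mul_assoc, mul_smul_comm,
      mul_assoc, smul_add, smul_sub, smul_smul, one_mul, mul_one, K_mul_F, Kinv_mul_F, K_mul_Kinv,
      Kinv_mul_K, E_mul_F, E_mul_K, E_mul_Kinv, asc (K_mul_F q), asc (Kinv_mul_F q),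
      asc (K_mul_Kinv q), asc (Kinv_mul_K q), asc (E_mul_F q), asc (E_mul_K q), asc (E_mul_Kinv q)]
    all_goals (match_scalars <;> field_simp <;> ring)

set_option linter.unusedSimpArgs false in
theorem casimir_rel' (hs : (q : 𝕜) - (q : 𝕜)⁻¹ ≠ 0) :
    ((q : 𝕜) - (q : 𝕜)⁻¹) ^ 2 • (genE q * genKinv q * genF q) =
      (q : 𝕜) ^ 2 • (casimir q * genKinv q) - (q : 𝕜) • 1
        - (q : 𝕜) ^ 3 • (genKinv q * genKinv q) ∧
    ((q : 𝕜) - (q : 𝕜)⁻¹) ^ 2 • (genF q * (genE q * genKinv q)) =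
      casimir q * genKinv q - (q : 𝕜) • 1 - (q : 𝕜)⁻¹ • (genKinv q * genKinv q) := by
  have hq : (q : 𝕜) ≠ 0 := q.ne_zero
  have hs' : (q : 𝕜) ^ 2 - 1 ≠ 0 := by
    intro h
    apply hs
    have h' : (q : 𝕜) - (q : 𝕜)⁻¹ = ((q : 𝕜) ^ 2 - 1) / q := by field_simp
    rw [h', h, zero_div]
  have asc : ∀ {x y z : Uq q}, x * y = z → ∀ w, x * (y * w) = z * w := by
    intro x y z h w; rw [← mul_assoc, h]
  refine ⟨?_, ?_⟩ <;>
  · simp only [casimir, mul_add, add_mul, mul_sub, sub_mul, smul_mul_assoc, mul_smul_comm,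
      mul_assoc, smul_add, smul_sub, smul_smul, one_mul, mul_one, K_mul_F, Kinv_mul_F, K_mul_Kinv,
      Kinv_mul_K, E_mul_F, E_mul_K, E_mul_Kinv, asc (K_mul_F q), asc (Kinv_mul_F q),
      asc (K_mul_Kinv q), asc (Kinv_mul_K q), asc (E_mul_F q), asc (E_mul_K q), asc (E_mul_Kinv q)]
    match_scalars <;> field_simp <;> ring

end relations

/-- A morphism on `I_R` exists as soon as the values satisfy the relations between the generators
and the value at `K⁻¹` becomes invertible in some larger algebra. -/
theorem IR_exists_hom (hs : (q : 𝕜) - (q : 𝕜)⁻¹ ≠ 0) {P Q : Type*} [Ring P] [Algebra 𝕜 P] [Ring Q]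
    [Algebra 𝕜 Q] (j : P →ₐ[𝕜] Q) (hj : Function.Injective j) (e f κ l : P) (K' : Q)
    (h1 : K' * j κ = 1) (h2 : j κ * K' = 1) (hκe : κ * e = (q : 𝕜)⁻¹ ^ 2 • (e * κ))
    (hκf : κ * f = (q : 𝕜) ^ 2 • (f * κ))
    (hef : ((q : 𝕜) - (q : 𝕜)⁻¹) ^ 2 • (e * f) =
      (q : 𝕜) ^ 2 • (l * κ) - (q : 𝕜) • 1 - (q : 𝕜) ^ 3 • (κ * κ))
    (hfe : ((q : 𝕜) - (q : 𝕜)⁻¹) ^ 2 • (f * e) = l * κ - (q : 𝕜) • 1 - (q : 𝕜)⁻¹ • (κ * κ)) :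
    ∃ ψ : IR q →ₐ[𝕜] P, ψ (irE q) = e ∧ ψ (irF q) = f ∧ ψ (irKinv q) = κ ∧ ψ (irCas q) = l := by
  have hq : (q : 𝕜) ≠ 0 := q.ne_zero
  have hs' : (q : 𝕜) ^ 2 - 1 ≠ 0 := by
    intro h
    apply hs
    have h' : (q : 𝕜) - (q : 𝕜)⁻¹ = ((q : 𝕜) ^ 2 - 1) / q := by field_simp
    rw [h', h, zero_div]
  replace hκe := congrArg j hκe
  replace hκf := congrArg j hκf
  replace hef := congrArg j hef
  replace hfe := congrArg j hfe
  simp only [map_mul, map_smul, map_sub, map_one] at hκe hκf hef hfe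
  have hKe : K' * j e = (q : 𝕜) ^ 2 • (j e * K') := by
    have h := congrArg (fun x => K' * x * K') hκe
    simp only [mul_smul_comm, smul_mul_assoc] at h
    rw [← mul_assoc, h1, one_mul, ← mul_assoc, mul_assoc, h2, mul_one] at h
    rw [h, smul_smul, ← mul_pow, mul_inv_cancel₀ hq, one_pow, one_smul]
  have hKf : K' * j f = (q : 𝕜)⁻¹ ^ 2 • (j f * K') := by
    have h := congrArg (fun x => K' * x * K') hκf
    simp only [mul_smul_comm, smul_mul_assoc] at h
    rw [← mul_assoc, h1, one_mul, ← mul_assoc, mul_assoc, h2, mul_one] at h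
    rw [h, smul_smul, ← mul_pow, inv_mul_cancel₀ hq, one_pow, one_smul]
  have e1 : j e * K' * j f = (q : 𝕜)⁻¹ ^ 2 • (j e * j f * K') := by
    rw [mul_assoc, hKf, mul_smul_comm, mul_assoc]
  have hef' : ((q : 𝕜) - (q : 𝕜)⁻¹) ^ 2 • (j e * j f * K') =
      (q : 𝕜) ^ 2 • j l - (q : 𝕜) • K' - (q : 𝕜) ^ 3 • j κ := by
    rw [← smul_mul_assoc, hef]
    simp only [sub_mul, smul_mul_assoc, mul_assoc, h2, mul_one, one_mul]
  have hfe' : ((q : 𝕜) - (q : 𝕜)⁻¹) ^ 2 • (j f * j e * K') =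
      j l - (q : 𝕜) • K' - (q : 𝕜)⁻¹ • j κ := by
    rw [← smul_mul_assoc, hfe]
    simp only [sub_mul, smul_mul_assoc, mul_assoc, h2, mul_one, one_mul]
  have hs2 := pow_ne_zero 2 hs
  have h5 : j e * K' * j f - j f * (j e * K') =
      ((q : 𝕜) - (q : 𝕜)⁻¹)⁻¹ • (K' - j κ) := by
    rw [e1, ← mul_assoc, ← inv_smul_smul₀ hs2 (j e * j f * K'),
      ← inv_smul_smul₀ hs2 (j f * j e * K'), hef', hfe']
    match_scalars <;> field_simp <;> ring
  let T : Uq q →ₐ[𝕜] Q := Uq.lift q (j e * K') (j f) K' (j κ) h1 h2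
    (by rw [← mul_assoc, hKe, smul_mul_assoc]) hKf h5
  have tE : T (genE q) = j e * K' := Uq.lift_genE ..
  have tF : T (genF q) = j f := Uq.lift_genF ..
  have tK : T (genK q) = K' := Uq.lift_genK ..
  have tk : T (genKinv q) = j κ := Uq.lift_genKinv ..
  obtain ⟨ψ, -, h⟩ := IR_exists_lift q j hj (T.comp (IR q).val) e f κ l
    (by
      change T (genE q * genKinv q) = j e
      rw [map_mul, tE, tk, mul_assoc, h1, mul_one])
    tF tk
    (by
      change T (casimir q) = j l
      simp only [casimir, map_add, map_smul, map_mul, tE, tF, tK, tk]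
      rw [e1, smul_comm, hef']
      match_scalars <;> field_simp <;> ring)
  exact ⟨ψ, h⟩

open Polynomial in
/-- The coaction `τ_R` exists and is determined by its values on the generators of `I_R`. -/
theorem existsUnique_tauR (hq : NotRootOfUnity q) : ∃! τ : IR q →ₐ[𝕜] Uq q ⊗[𝕜] IR q,
    τ (irE q) = genKinv q ⊗ₜ irE q ∧
    τ (irF q) = genK q ⊗ₜ irF q
      - ((q : 𝕜)⁻¹ ^ 3 * ((q : 𝕜) - (q : 𝕜)⁻¹) ^ 2) • ((genF q ^ 2 * genK q) ⊗ₜ irE q)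
      + ((q : 𝕜)⁻¹ * ((q : 𝕜) + (q : 𝕜)⁻¹)) • ((genF q * genK q) ⊗ₜ irKinv q)
      - (q : 𝕜)⁻¹ • ((genF q * genK q) ⊗ₜ irCas q) ∧
    τ (irKinv q) = 1 ⊗ₜ irKinv q
      - ((q : 𝕜)⁻¹ * ((q : 𝕜) - (q : 𝕜)⁻¹) ^ 2) • (genF q ⊗ₜ irE q) ∧
    τ (irCas q) = 1 ⊗ₜ irCas q := by
  have hq0 : (q : 𝕜) ≠ 0 := q.ne_zero
  have hs : (q : 𝕜) - (q : 𝕜)⁻¹ ≠ 0 := by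
    intro h
    apply hq 2 two_pos
    ext
    have := congrArg (fun t => (q : 𝕜) * t) (sub_eq_zero.1 h)
    simpa [pow_two, hq0] using this
  -- the morphism with a formal variable `X` that counts the degree in the first factor
  let i₁ : Uq q →ₐ[𝕜] (Uq q ⊗[𝕜] Uq q)[X] :=
    (Polynomial.CAlgHom).comp Algebra.TensorProduct.includeLeft
  let i₂ : Uq q →ₐ[𝕜] (Uq q ⊗[𝕜] Uq q)[X] :=
    (Polynomial.CAlgHom).comp Algebra.TensorProduct.includeRight
  have hi₁ : ∀ x, i₁ x = C (x ⊗ₜ 1) := fun x => rfl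
  have hi₂ : ∀ x, i₂ x = C (1 ⊗ₜ x) := fun x => rfl
  have hc : ∀ x y, i₂ y * i₁ x = i₁ x * i₂ y := fun x y => by
    rw [hi₁, hi₂, ← C_mul, ← C_mul, Algebra.TensorProduct.tmul_mul_tmul,
      Algebra.TensorProduct.tmul_mul_tmul, one_mul, mul_one, one_mul, mul_one]
  have hX : ∀ x y, i₂ y * (X * i₁ x) = X * i₁ x * i₂ y := fun x y => by
    rw [← mul_assoc, ← X_mul, mul_assoc, hc, mul_assoc]
  obtain ⟨c1, c2, c3, c4⟩ := casimir_rel q hs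
  obtain ⟨c5, c6⟩ := casimir_rel' q hs
  obtain ⟨r1, r2, r3, r4⟩ := twist_relations hq0 hs (X * i₁ (genF q)) (i₁ (genK q))
    (i₁ (genKinv q)) (i₂ (genE q * genKinv q)) (i₂ (genF q)) (i₂ (genKinv q)) (i₂ (casimir q))
    (by rw [← map_mul, K_mul_Kinv, map_one])
    (by rw [← map_mul, Kinv_mul_K, map_one])
    (by rw [← mul_assoc, ← X_mul, mul_assoc, ← map_mul, K_mul_F, map_smul, map_mul,
      mul_smul_comm, mul_assoc])
    (hX _ _) (hc _ _) (hc _ _) (hX _ _) (hc _ _) (hc _ _) (hX _ _) (hc _ _) (hc _ _) (hX _ _)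
    (hc _ _) (hc _ _)
    (by rw [← map_mul, ← map_mul, ← mul_assoc, c1, mul_assoc, c3, mul_assoc])
    (by rw [← map_mul, ← map_mul, c2])
    (by rw [← map_mul, ← map_mul, c3])
    (by rw [← map_mul, ← map_mul, ← map_smul, c4])
    (by rw [← map_mul, ← map_mul, ← map_smul, Kinv_mul_F])
    (by simp only [← map_mul, ← map_smul, c5]; simp only [map_sub, map_smul, map_one])
    (by simp only [← map_mul, ← map_smul, c6]; simp only [map_sub, map_smul, map_one])
    rfl rfl rfl
  let j : (Uq q ⊗[𝕜] Uq q)[X] →ₐ[𝕜] PowerSeries (Uq q ⊗[𝕜] Uq q) :=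
    { Polynomial.coeToPowerSeries.ringHom with
      commutes' := fun a => by
        change ((algebraMap 𝕜 (Uq q ⊗[𝕜] Uq q)[X] a : (Uq q ⊗[𝕜] Uq q)[X]) :
          PowerSeries (Uq q ⊗[𝕜] Uq q)) = _
        rw [Polynomial.algebraMap_apply, Polynomial.coe_C, PowerSeries.algebraMap_apply] }
  have hj : Function.Injective j := Polynomial.coe_injective _
  have hjX : j X = PowerSeries.X := Polynomial.coe_X
  have hjC : ∀ v, j (C v) = PowerSeries.C v := fun v => Polynomial.coe_C v
  -- a geometric series inverts the value at `K⁻¹`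
  obtain ⟨y, hy⟩ : ∃ y : Uq q ⊗[𝕜] Uq q, i₂ (genKinv q)
      - ((q : 𝕜)⁻¹ * ((q : 𝕜) - (q : 𝕜)⁻¹) ^ 2) • (X * i₁ (genF q) * i₂ (genE q * genKinv q)) =
      (1 - X * C y) * i₂ (genKinv q) := by
    refine ⟨((q : 𝕜)⁻¹ * ((q : 𝕜) - (q : 𝕜)⁻¹) ^ 2) • (genF q ⊗ₜ genE q), ?_⟩
    have h : i₁ (genF q) * i₂ (genE q) = C (genF q ⊗ₜ genE q) := by
      rw [hi₁, hi₂, ← C_mul, Algebra.TensorProduct.tmul_mul_tmul, one_mul, mul_one]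
    rw [sub_mul, one_mul, ← smul_C, mul_smul_comm, smul_mul_assoc, map_mul i₂, ← h]
    simp only [mul_assoc]
  have g1 : (1 - PowerSeries.X * PowerSeries.C y) * PowerSeries.mk (fun n => y ^ n) = 1 := by
    ext n
    rw [sub_mul, one_mul, mul_assoc, map_sub]
    cases n with
    | zero => simp
    | succ n =>
      rw [PowerSeries.coeff_succ_X_mul, PowerSeries.coeff_C_mul]
      simp [pow_succ', PowerSeries.coeff_one]
  have g2 : PowerSeries.mk (fun n => y ^ n) * (1 - PowerSeries.X * PowerSeries.C y) = 1 := by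
    ext n
    rw [mul_sub, mul_one, ← mul_assoc, map_sub, PowerSeries.coeff_mul_C]
    cases n with
    | zero => simp
    | succ n =>
      rw [PowerSeries.coeff_succ_mul_X]
      simp [pow_succ, PowerSeries.coeff_one]
  obtain ⟨ψ, p1, p2, p3, p4⟩ := IR_exists_hom q hs j hj _ _ _ _
    (j (i₂ (genK q)) * PowerSeries.mk (fun n => y ^ n))
    (by
      rw [hy, map_mul, map_sub, map_one, map_mul, hjX, hjC, mul_assoc, ← mul_assoc _ _ (j _), g2,
        one_mul, ← map_mul, ← map_mul, K_mul_Kinv, map_one, map_one])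
    (by
      rw [hy, map_mul, map_sub, map_one, map_mul, hjX, hjC, mul_assoc, ← mul_assoc (j _) (j _),
        ← map_mul, ← map_mul, Kinv_mul_K, map_one, map_one, one_mul, g1]) r1 r2 r3 r4
  let ev : (Uq q ⊗[𝕜] Uq q)[X] →ₐ[𝕜] Uq q ⊗[𝕜] Uq q :=
    Polynomial.eval₂AlgHom (AlgHom.id 𝕜 _) 1 (fun a => Commute.one_right _)
  have evX : ev X = 1 := Polynomial.eval₂_X _ _
  have ev₁ : ∀ x, ev (i₁ x) = x ⊗ₜ 1 := fun x => Polynomial.eval₂_C _ _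
  have ev₂ : ∀ x, ev (i₂ x) = 1 ⊗ₜ x := fun x => Polynomial.eval₂_C _ _
  obtain ⟨τ, -, h⟩ := IR_exists_lift q (inclR q) (inclR_injective q) (ev.comp ψ)
    (genKinv q ⊗ₜ irE q)
    (genK q ⊗ₜ irF q
      - ((q : 𝕜)⁻¹ ^ 3 * ((q : 𝕜) - (q : 𝕜)⁻¹) ^ 2) • ((genF q ^ 2 * genK q) ⊗ₜ irE q)
      + ((q : 𝕜)⁻¹ * ((q : 𝕜) + (q : 𝕜)⁻¹)) • ((genF q * genK q) ⊗ₜ irKinv q)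
      - (q : 𝕜)⁻¹ • ((genF q * genK q) ⊗ₜ irCas q))
    (1 ⊗ₜ irKinv q - ((q : 𝕜)⁻¹ * ((q : 𝕜) - (q : 𝕜)⁻¹) ^ 2) • (genF q ⊗ₜ irE q))
    (1 ⊗ₜ irCas q)
    (by
      change ev (ψ _) = _
      rw [p1, map_mul, ev₁, ev₂, inclR_tmul, Algebra.TensorProduct.tmul_mul_tmul, one_mul,
        mul_one]
      rfl)
    (by
      change ev (ψ _) = _
      rw [p2]
      simp only [map_sub, map_add, map_smul, map_mul, map_pow, inclR_tmul, evX, ev₁, ev₂,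
        Algebra.TensorProduct.tmul_mul_tmul, Algebra.TensorProduct.tmul_pow, one_mul, mul_one,
        one_pow]
      rfl)
    (by
      change ev (ψ _) = _
      rw [p3]
      simp only [map_sub, map_smul, map_mul, inclR_tmul, evX, ev₁, ev₂,
        Algebra.TensorProduct.tmul_mul_tmul, one_mul, mul_one]
      rfl)
    (by
      change ev (ψ _) = _
      rw [p4, ev₂]
      rfl)
  refine ⟨τ, h, fun τ' h' => ?_⟩
  exact IR_hom_ext q (h'.1.trans h.1.symm) (h'.2.1.trans h.2.1.symm)
    (h'.2.2.1.trans h.2.2.1.symm) (h'.2.2.2.trans h.2.2.2.symm)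

/-- The coaction `τ_R : I_R → U ⊗ I_R`. -/
def tauR (hq : NotRootOfUnity q) : IR q →ₐ[𝕜] Uq q ⊗[𝕜] IR q := (existsUnique_tauR q hq).choose

theorem tauR_spec (hq : NotRootOfUnity q) :
    tauR q hq (irE q) = genKinv q ⊗ₜ irE q ∧
    tauR q hq (irF q) = genK q ⊗ₜ irF q
      - ((q : 𝕜)⁻¹ ^ 3 * ((q : 𝕜) - (q : 𝕜)⁻¹) ^ 2) • ((genF q ^ 2 * genK q) ⊗ₜ irE q)
      + ((q : 𝕜)⁻¹ * ((q : 𝕜) + (q : 𝕜)⁻¹)) • ((genF q * genK q) ⊗ₜ irKinv q)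
      - (q : 𝕜)⁻¹ • ((genF q * genK q) ⊗ₜ irCas q) ∧
    tauR q hq (irKinv q) = 1 ⊗ₜ irKinv q
      - ((q : 𝕜)⁻¹ * ((q : 𝕜) - (q : 𝕜)⁻¹) ^ 2) • (genF q ⊗ₜ irE q) ∧
    tauR q hq (irCas q) = 1 ⊗ₜ irCas q :=
  (existsUnique_tauR q hq).choose_spec.1

/-! ### Tensor powers and the elements `Λ_A` -/

/-- `U^{⊗ n} ⊗ B`, i.e. `U ⊗ (U ⊗ (⋯ ⊗ B))` with `n` factors `U`, as an algebra. -/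
def tensorTower (B : AlgCat.{u} 𝕜) : ℕ → AlgCat.{u} 𝕜
  | 0 => B
  | n + 1 => AlgCat.of 𝕜 (Uq q ⊗[𝕜] tensorTower B n)

/-- The algebra `U^{⊗ n}`, realized as `U ⊗ (U ⊗ (⋯ ⊗ 𝕜))`. -/
abbrev tensorPow (n : ℕ) : AlgCat.{u} 𝕜 := tensorTower q (AlgCat.of 𝕜 𝕜) n

/-- The algebra `U^{⊗ n} ⊗ I_R`. -/
abbrev tensorPowIR (n : ℕ) : AlgCat.{u} 𝕜 := tensorTower q (AlgCat.of 𝕜 (IR q)) n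

/-- For `φ : I_R → U ⊗ I_R`, the morphism
`1^{⊗ n} ⊗ φ : U^{⊗ n} ⊗ I_R → U^{⊗ (n + 1)} ⊗ I_R`. -/
def onLast (φ : IR q →ₐ[𝕜] Uq q ⊗[𝕜] IR q) :
    (n : ℕ) → tensorPowIR q n →ₐ[𝕜] tensorPowIR q (n + 1)
  | 0 => φ
  | n + 1 => Algebra.TensorProduct.map (AlgHom.id 𝕜 (Uq q)) (onLast φ n)

/-- `placeAt p s n x = 1^{⊗ p} ⊗ x ⊗ 1^{⊗ (n - p - s - 1)}` for `x ∈ U^{⊗ s} ⊗ I_R`, as an element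
of `U^{⊗ n}`; it is meant for `p + s + 1 ≤ n` and is `0` otherwise. -/
def placeAt : (p s n : ℕ) → tensorPowIR q s →ₗ[𝕜] tensorPow q n
  | _, _, 0 => 0
  | 0, 0, n + 1 =>
    ((Algebra.TensorProduct.includeLeft : Uq q →ₐ[𝕜] Uq q ⊗[𝕜] tensorPow q n).comp
      (IR q).val).toLinearMap
  | 0, s + 1, n + 1 => TensorProduct.map LinearMap.id (placeAt 0 s n)
  | p + 1, s, n + 1 =>
    (Algebra.TensorProduct.includeRight :
      tensorPow q n →ₐ[𝕜] Uq q ⊗[𝕜] tensorPow q n).toLinearMap ∘ₗ placeAt p s n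

/-- The successive stages of the right extension process for a set `A` with minimum `a`. The stage
`s + 1` is obtained from the stage `s` by `1^{⊗ s} ⊗ Δ` if `a + s ∈ A` and by `1^{⊗ s} ⊗ τ_R` if
`a + s ∉ A`. So for consecutive elements `a_{i-1} < a_i` of `A` one applies first
`1^{⊗ (a_{i-1} - a)} ⊗ Δ` and then `1^{⊗ ℓ} ⊗ τ_R` for `ℓ = a_{i-1} - a + 1, …, a_i - a - 1`. -/
def extensionStage (hq : NotRootOfUnity q) (A : Finset ℕ) (a : ℕ) : (s : ℕ) → tensorPowIR q s
  | 0 => irCas q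
  | s + 1 =>
    onLast q (if a + s ∈ A then coprodR q else tauR q hq) s (extensionStage hq A a s)

/-- The outcome of the right extension process for a set `A` with minimum `a` and maximum `b`, as an
element of `U^{⊗ n}`, i.e. completed with `1^{⊗ (a - 1)}` on the left and `1^{⊗ (n - b)}` on the
right. -/
def rightExtension (hq : NotRootOfUnity q) (n : ℕ) (A : Finset ℕ) (a b : ℕ) : tensorPow q n :=
  placeAt q (a - 1) (b - a) n (extensionStage q hq A a (b - a))

/-- The element `Λ_A` of `U^{⊗ n}` for `A ⊆ {1, …, n}`, obtained by the right extension process;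
`Λ_∅ = q + q⁻¹`. -/
def Lam (hq : NotRootOfUnity q) (n : ℕ) (A : Finset ℕ) : tensorPow q n :=
  if h : A.Nonempty then rightExtension q hq n A (A.min' h) (A.max' h)
  else algebraMap 𝕜 (tensorPow q n) ((q : 𝕜) + (q : 𝕜)⁻¹)

/-- The `q`-commutator `[x, y]_q = q x y - q⁻¹ y x`. -/
def qComm {R : Type*} [Ring R] [Algebra 𝕜 R] (x y : R) : R :=
  (q : 𝕜) • (x * y) - (q : 𝕜)⁻¹ • (y * x)

/-- The standard relation for the sets `A` and `B`, in `U^{⊗ n}`. -/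
def StandardRelation (hq : NotRootOfUnity q) (n : ℕ) (A B : Finset ℕ) : Prop :=
  qComm q (Lam q hq n A) (Lam q hq n B) =
    ((q : 𝕜)⁻¹ ^ 2 - (q : 𝕜) ^ 2) • Lam q hq n ((A ∪ B) \ (A ∩ B))
      + ((q : 𝕜) - (q : 𝕜)⁻¹) • (Lam q hq n (A ∩ B) * Lam q hq n (A ∪ B)
        + Lam q hq n (A \ (A ∩ B)) * Lam q hq n (B \ (A ∩ B)))

end

/-- The arithmetic progression `{a, a + 2, …, a + 2 (m - 1)}` with `m` terms. -/
def stepTwo (a m : ℕ) : Finset ℕ := (Finset.range m).image (fun i => a + 2 * i)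

end AskeyWilson

end

open AskeyWilson

/-! Everything is read off from the matrix `L` with rows `(K⁻¹, q(q-q⁻¹)²F)` and `(EK⁻¹, qΛ-q²K⁻¹)`.
Its entries span the same space as the generators of `I_R`, and its quantum trace `q L₀₀ + q⁻¹ L₁₁`
is `Λ`. In these terms `τ_R` applied entrywise to `L` is conjugation of `1 ⊗ L` by an upper
triangular matrix over the first tensor factor (`tauR_irL`), and `Δ(L) = (L ⊗ 1) · τ_R(L)`
(`coprodR_irL`). A step at a gap of `A` therefore only conjugates, and a step at an element of `A`
also contributes a factor `L`. Iterating, `Λ_A` is the quantum trace of an ordered product `T_A` of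
dressed copies of `L`, one for each element of `A` (`Lam_eq_qTrace`). Conjugation is multiplicative,
so `T_{A ∪ B} = T_A T_B` whenever `A` lies to the left of `B` (`monodromy_union`).

Each `T_A` solves a reflection equation with quantum determinant 1 (`isReflection_monodromy`), and
`T_A`, `T_B` satisfy quadratic exchange relations when `A` lies to the left of `B`
(`isExchange_monodromy`). Both facts come from the defining relations of `U_q(sl₂)` and survive
products and conjugation.

The standard relation thus becomes an identity for four matrices `M₁, …, M₄` attached to successive
blocks `A₁ < A₂ < A₃ < A₄`, some possibly empty. Every pair in the theorem has one of three shapes: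
`(A₁A₂A₄, A₂A₃)`, `(A₂A₃, A₁A₃A₄)` or `(A₁A₃A₄, A₁A₂A₄)`. For the first two, an identity between the
entries of `M₂`, `M₃` and the trace of `M₂M₃` is sandwiched between `M₁` and `M₄`; the traces can be
moved out because they commute with the outer matrices. For the third, everything is expanded in
ordered quadratic monomials in the entries of `M₁`, and coefficients are compared. -/

namespace AskeyWilson

/-! ### Reflection and exchange relations for 2 × 2 matrices -/

section LoopAlgebra

variable {𝕜 W : Type*} [Field 𝕜] [Ring W] [Algebra 𝕜 W]

/-- The relations between the entries of a `2 × 2` matrix that solves the reflection equation and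
has quantum determinant `1`. -/
structure IsReflection (q : 𝕜) (M : Matrix (Fin 2) (Fin 2) W) : Prop where
  ac : M 0 0 * M 1 0 = q⁻¹ ^ 2 • (M 1 0 * M 0 0)
  ab : M 0 0 * M 0 1 = q ^ 2 • (M 0 1 * M 0 0)
  da : M 1 1 * M 0 0 = 1 + q⁻¹ ^ 2 • (M 1 0 * M 0 1)
  ad : M 0 0 * M 1 1 = 1 + q⁻¹ ^ 2 • (M 1 0 * M 0 1)
  dc : M 1 1 * M 1 0 = M 1 0 * M 1 1 + (q ^ 2 - 1) • (M 1 0 * M 0 0)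
  db : M 1 1 * M 0 1 = M 0 1 * M 1 1 + (q ^ 2 * (1 - q ^ 2)) • (M 0 1 * M 0 0)
  bc : M 0 1 * M 1 0 = q⁻¹ ^ 2 • (M 1 0 * M 0 1) + (1 - q ^ 2) • (1 - M 0 0 * M 0 0)

/-- The exchange relations between the entries of two `2 × 2` matrices, written as rules that move
the entries of `M` to the left of the entries of `N`. -/
structure IsExchange (q : 𝕜) (M N : Matrix (Fin 2) (Fin 2) W) : Prop where
  aa : N 0 0 * M 0 0 = M 0 0 * N 0 0 + (1 - q⁻¹ ^ 2) • (M 0 1 * N 1 0)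
  ab : N 0 0 * M 0 1 = M 0 1 * N 0 0
  ac : N 0 0 * M 1 0 = M 1 0 * N 0 0 + (1 - q⁻¹ ^ 2) • (M 1 1 * N 1 0 - M 0 0 * N 1 0)
  ad : N 0 0 * M 1 1 = M 1 1 * N 0 0 - (q ^ 2 - 1) • (M 0 1 * N 1 0)
  ba : N 0 1 * M 0 0 = M 0 0 * N 0 1 + (1 - q⁻¹ ^ 2) • (M 0 1 * N 1 1 - M 0 1 * N 0 0)
  bb : N 0 1 * M 0 1 = q⁻¹ ^ 2 • (M 0 1 * N 0 1)
  bc : N 0 1 * M 1 0 = q ^ 2 • (M 1 0 * N 0 1) + (q ^ 2 - 1) • (M 0 0 * N 0 0 - M 0 0 * N 1 1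
    - M 1 1 * N 0 0 + M 1 1 * N 1 1) + ((q ^ 2 - 1) * (q ^ 2 - q⁻¹ ^ 2)) • (M 0 1 * N 1 0)
  bd : N 0 1 * M 1 1 = M 1 1 * N 0 1 + (q ^ 2 - 1) • (M 0 1 * N 0 0 - M 0 1 * N 1 1)
  ca : N 1 0 * M 0 0 = M 0 0 * N 1 0
  cb : N 1 0 * M 0 1 = q ^ 2 • (M 0 1 * N 1 0)
  cc : N 1 0 * M 1 0 = q⁻¹ ^ 2 • (M 1 0 * N 1 0)
  cd : N 1 0 * M 1 1 = M 1 1 * N 1 0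
  da : N 1 1 * M 0 0 = M 0 0 * N 1 1 - (q ^ 2 - 1) • (M 0 1 * N 1 0)
  db : N 1 1 * M 0 1 = M 0 1 * N 1 1
  dc : N 1 1 * M 1 0 = M 1 0 * N 1 1 + (q ^ 2 - 1) • (M 0 0 * N 1 0 - M 1 1 * N 1 0)
  dd : N 1 1 * M 1 1 = M 1 1 * N 1 1 + (q ^ 2 * (q ^ 2 - 1)) • (M 0 1 * N 1 0)

/-- The quantum trace of a `2 × 2` matrix. -/
def qTrace (q : 𝕜) (M : Matrix (Fin 2) (Fin 2) W) : W := q • M 0 0 + q⁻¹ • M 1 1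

theorem mul_mul_of_mul_eq {x y z : W} (h : x * y = z) (w : W) : x * (y * w) = z * w := by
  rw [← mul_assoc, h]

variable {q : 𝕜} {M M' N N' : Matrix (Fin 2) (Fin 2) W}

/-- The relations as a set of rewriting rules for right associated words. -/
theorem IsReflection.rules (h : IsReflection q M) :
    (M 0 0 * M 1 0 = q⁻¹ ^ 2 • (M 1 0 * M 0 0)) ∧
    (M 0 0 * M 0 1 = q ^ 2 • (M 0 1 * M 0 0)) ∧
    (M 1 1 * M 0 0 = 1 + q⁻¹ ^ 2 • (M 1 0 * M 0 1)) ∧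
    (M 0 0 * M 1 1 = 1 + q⁻¹ ^ 2 • (M 1 0 * M 0 1)) ∧
    (M 1 1 * M 1 0 = M 1 0 * M 1 1 + (q ^ 2 - 1) • (M 1 0 * M 0 0)) ∧
    (M 1 1 * M 0 1 = M 0 1 * M 1 1 + (q ^ 2 * (1 - q ^ 2)) • (M 0 1 * M 0 0)) ∧
    (M 0 1 * M 1 0 = q⁻¹ ^ 2 • (M 1 0 * M 0 1) + (1 - q ^ 2) • (1 - M 0 0 * M 0 0)) ∧
    (∀ w, M 0 0 * (M 1 0 * w) = (q⁻¹ ^ 2 • (M 1 0 * M 0 0)) * w) ∧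
    (∀ w, M 0 0 * (M 0 1 * w) = (q ^ 2 • (M 0 1 * M 0 0)) * w) ∧
    (∀ w, M 1 1 * (M 0 0 * w) = (1 + q⁻¹ ^ 2 • (M 1 0 * M 0 1)) * w) ∧
    (∀ w, M 0 0 * (M 1 1 * w) = (1 + q⁻¹ ^ 2 • (M 1 0 * M 0 1)) * w) ∧
    (∀ w, M 1 1 * (M 1 0 * w) = (M 1 0 * M 1 1 + (q ^ 2 - 1) • (M 1 0 * M 0 0)) * w) ∧
    (∀ w, M 1 1 * (M 0 1 * w) = (M 0 1 * M 1 1 + (q ^ 2 * (1 - q ^ 2)) • (M 0 1 * M 0 0)) * w) ∧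
    (∀ w, M 0 1 * (M 1 0 * w) = (q⁻¹ ^ 2 • (M 1 0 * M 0 1) + (1 - q ^ 2) • (1
      - M 0 0 * M 0 0)) * w) :=
  ⟨h.ac, h.ab, h.da, h.ad, h.dc, h.db, h.bc, mul_mul_of_mul_eq h.ac, mul_mul_of_mul_eq h.ab,
    mul_mul_of_mul_eq h.da, mul_mul_of_mul_eq h.ad, mul_mul_of_mul_eq h.dc,
    mul_mul_of_mul_eq h.db, mul_mul_of_mul_eq h.bc⟩

/-- The relations as a set of rewriting rules for right associated words. -/
theorem IsExchange.rules (h : IsExchange q M N) :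
    (N 0 0 * M 0 0 = M 0 0 * N 0 0 + (1 - q⁻¹ ^ 2) • (M 0 1 * N 1 0)) ∧
    (N 0 0 * M 0 1 = M 0 1 * N 0 0) ∧
    (N 0 0 * M 1 0 = M 1 0 * N 0 0 + (1 - q⁻¹ ^ 2) • (M 1 1 * N 1 0 - M 0 0 * N 1 0)) ∧
    (N 0 0 * M 1 1 = M 1 1 * N 0 0 - (q ^ 2 - 1) • (M 0 1 * N 1 0)) ∧
    (N 0 1 * M 0 0 = M 0 0 * N 0 1 + (1 - q⁻¹ ^ 2) • (M 0 1 * N 1 1 - M 0 1 * N 0 0)) ∧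
    (N 0 1 * M 0 1 = q⁻¹ ^ 2 • (M 0 1 * N 0 1)) ∧
    (N 0 1 * M 1 0 = q ^ 2 • (M 1 0 * N 0 1) + (q ^ 2 - 1) • (M 0 0 * N 0 0 - M 0 0 * N 1 1
      - M 1 1 * N 0 0 + M 1 1 * N 1 1) + ((q ^ 2 - 1) * (q ^ 2 - q⁻¹ ^ 2)) • (M 0 1 * N 1 0)) ∧
    (N 0 1 * M 1 1 = M 1 1 * N 0 1 + (q ^ 2 - 1) • (M 0 1 * N 0 0 - M 0 1 * N 1 1)) ∧
    (N 1 0 * M 0 0 = M 0 0 * N 1 0) ∧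
    (N 1 0 * M 0 1 = q ^ 2 • (M 0 1 * N 1 0)) ∧
    (N 1 0 * M 1 0 = q⁻¹ ^ 2 • (M 1 0 * N 1 0)) ∧
    (N 1 0 * M 1 1 = M 1 1 * N 1 0) ∧
    (N 1 1 * M 0 0 = M 0 0 * N 1 1 - (q ^ 2 - 1) • (M 0 1 * N 1 0)) ∧
    (N 1 1 * M 0 1 = M 0 1 * N 1 1) ∧
    (N 1 1 * M 1 0 = M 1 0 * N 1 1 + (q ^ 2 - 1) • (M 0 0 * N 1 0 - M 1 1 * N 1 0)) ∧
    (N 1 1 * M 1 1 = M 1 1 * N 1 1 + (q ^ 2 * (q ^ 2 - 1)) • (M 0 1 * N 1 0)) ∧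
    (∀ w, N 0 0 * (M 0 0 * w) = (M 0 0 * N 0 0 + (1 - q⁻¹ ^ 2) • (M 0 1 * N 1 0)) * w) ∧
    (∀ w, N 0 0 * (M 0 1 * w) = (M 0 1 * N 0 0) * w) ∧
    (∀ w, N 0 0 * (M 1 0 * w) = (M 1 0 * N 0 0 + (1 - q⁻¹ ^ 2) • (M 1 1 * N 1 0
      - M 0 0 * N 1 0)) * w) ∧
    (∀ w, N 0 0 * (M 1 1 * w) = (M 1 1 * N 0 0 - (q ^ 2 - 1) • (M 0 1 * N 1 0)) * w) ∧
    (∀ w, N 0 1 * (M 0 0 * w) = (M 0 0 * N 0 1 + (1 - q⁻¹ ^ 2) • (M 0 1 * N 1 1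
      - M 0 1 * N 0 0)) * w) ∧
    (∀ w, N 0 1 * (M 0 1 * w) = (q⁻¹ ^ 2 • (M 0 1 * N 0 1)) * w) ∧
    (∀ w, N 0 1 * (M 1 0 * w) = (q ^ 2 • (M 1 0 * N 0 1) + (q ^ 2 - 1) • (M 0 0 * N 0 0
      - M 0 0 * N 1 1 - M 1 1 * N 0 0 + M 1 1 * N 1 1) + ((q ^ 2 - 1) * (q ^ 2
      - q⁻¹ ^ 2)) • (M 0 1 * N 1 0)) * w) ∧
    (∀ w, N 0 1 * (M 1 1 * w) = (M 1 1 * N 0 1 + (q ^ 2 - 1) • (M 0 1 * N 0 0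
      - M 0 1 * N 1 1)) * w) ∧
    (∀ w, N 1 0 * (M 0 0 * w) = (M 0 0 * N 1 0) * w) ∧
    (∀ w, N 1 0 * (M 0 1 * w) = (q ^ 2 • (M 0 1 * N 1 0)) * w) ∧
    (∀ w, N 1 0 * (M 1 0 * w) = (q⁻¹ ^ 2 • (M 1 0 * N 1 0)) * w) ∧
    (∀ w, N 1 0 * (M 1 1 * w) = (M 1 1 * N 1 0) * w) ∧
    (∀ w, N 1 1 * (M 0 0 * w) = (M 0 0 * N 1 1 - (q ^ 2 - 1) • (M 0 1 * N 1 0)) * w) ∧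
    (∀ w, N 1 1 * (M 0 1 * w) = (M 0 1 * N 1 1) * w) ∧
    (∀ w, N 1 1 * (M 1 0 * w) = (M 1 0 * N 1 1 + (q ^ 2 - 1) • (M 0 0 * N 1 0
      - M 1 1 * N 1 0)) * w) ∧
    (∀ w, N 1 1 * (M 1 1 * w) = (M 1 1 * N 1 1 + (q ^ 2 * (q ^ 2 - 1)) • (M 0 1 * N 1 0)) * w) :=
  ⟨h.aa, h.ab, h.ac, h.ad, h.ba, h.bb, h.bc, h.bd, h.ca, h.cb, h.cc, h.cd, h.da, h.db, h.dc,
    h.dd, mul_mul_of_mul_eq h.aa, mul_mul_of_mul_eq h.ab, mul_mul_of_mul_eq h.ac,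
    mul_mul_of_mul_eq h.ad, mul_mul_of_mul_eq h.ba, mul_mul_of_mul_eq h.bb,
    mul_mul_of_mul_eq h.bc, mul_mul_of_mul_eq h.bd, mul_mul_of_mul_eq h.ca,
    mul_mul_of_mul_eq h.cb, mul_mul_of_mul_eq h.cc, mul_mul_of_mul_eq h.cd,
    mul_mul_of_mul_eq h.da, mul_mul_of_mul_eq h.db, mul_mul_of_mul_eq h.dc,
    mul_mul_of_mul_eq h.dd⟩

theorem IsReflection.one : IsReflection q (1 : Matrix (Fin 2) (Fin 2) W) := by
  constructor <;> simp

theorem IsExchange.one_left : IsExchange q (1 : Matrix (Fin 2) (Fin 2) W) N := by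
  constructor <;> simp

/-- An entry of `N` is moved past `M` and then past `M'`, so no relation between `M` and `M'` is
needed. Together with `IsExchange.mul_right` this lets a whole block of positions be treated as a
single matrix. -/
theorem IsExchange.mul_left (hq : q ≠ 0) (h : IsExchange q M N) (h' : IsExchange q M' N) :
    IsExchange q (M * M') N := by
  constructor <;>
  · simp only [Matrix.mul_apply, Fin.sum_univ_two, mul_add, add_mul, mul_sub, sub_mul, smul_add,
      smul_sub, smul_smul, smul_mul_assoc, mul_smul_comm, mul_assoc, mul_one, one_mul, h.rules, h'.rules]
    all_goals (match_scalars <;> field_simp <;> ring)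

theorem IsExchange.mul_right (hq : q ≠ 0) (h : IsExchange q M N) (h' : IsExchange q M N') :
    IsExchange q M (N * N') := by
  constructor <;>
  · simp only [Matrix.mul_apply, Fin.sum_univ_two, mul_add, add_mul, mul_sub, sub_mul, smul_add,
      smul_sub, smul_smul, smul_mul_assoc, mul_smul_comm, mul_assoc, mul_one, one_mul, h.rules, h'.rules]
    all_goals (match_scalars <;> field_simp <;> ring)

/-- The exchange relations bring words in the two matrices to the order "`M` before `N`", after
which the relations of each matrix apply separately. The determinant condition, which is the
constant 1 in `da` and `ad`, is preserved as well. -/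
theorem IsReflection.mul (hq : q ≠ 0) (hM : IsReflection q M) (hN : IsReflection q N)
    (h : IsExchange q M N) : IsReflection q (M * N) := by
  constructor <;>
  · simp only [Matrix.mul_apply, Fin.sum_univ_two, mul_add, add_mul, mul_sub, sub_mul, smul_add,
      smul_sub, smul_smul, smul_mul_assoc, mul_smul_comm, mul_assoc, mul_one, one_mul, h.rules, hM.rules, hN.rules]
    match_scalars <;> field_simp <;> ring

/-- The weights `q` and `q⁻¹` are those for which the correction terms in the exchange rules cancel.
This centrality is what allows traces to be pulled out of longer products. -/
theorem IsExchange.commute_qTrace_left (hq : q ≠ 0) (h : IsExchange q M N) (i j : Fin 2) :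
    Commute (qTrace q M) (N i j) := by
  rw [Commute, SemiconjBy]
  fin_cases i <;> fin_cases j <;>
  · simp only [qTrace, Fin.zero_eta, Fin.mk_one, mul_add, add_mul, smul_mul_assoc, mul_smul_comm,
      h.rules]
    all_goals (match_scalars <;> field_simp <;> ring)

theorem IsExchange.commute_qTrace_right (hq : q ≠ 0) (h : IsExchange q M N) (i j : Fin 2) :
    Commute (qTrace q N) (M i j) := by
  rw [Commute, SemiconjBy]
  fin_cases i <;> fin_cases j <;>
  · simp only [qTrace, Fin.zero_eta, Fin.mk_one, mul_add, add_mul, smul_mul_assoc, mul_smul_comm,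
      h.rules]
    all_goals (match_scalars <;> field_simp <;> ring)

end LoopAlgebra

/-! ### The trace identity when the two outer blocks are shared -/

section LoopAlgebra

variable {𝕜 W : Type*} [Field 𝕜] [Ring W] [Algebra 𝕜 W] {q : 𝕜}
  {M N P M1 M2 M3 M4 : Matrix (Fin 2) (Fin 2) W}

/-- The product of the quantum traces of `M N` and `M P`, expanded in the ordered quadratic monomials
in the entries of `M`. -/
theorem IsReflection.qTrace_mul_qTrace (hq : q ≠ 0) (hM : IsReflection q M) (h : IsExchange q M N) :
    qTrace q (M * N) * qTrace q (M * P) =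
      ((1 - q⁻¹ ^ 2) • (N 1 0 * P 0 1) + (N 1 1 * P 0 0) + (N 0 0 * P 1 1))
      + M 0 0 * M 0 0 * (q ^ 2 • (N 0 0 * P 0 0))
      + M 1 0 * M 1 0 * ((N 0 1 * P 0 1))
      + M 0 1 * M 0 1 * (q ^ 4 • (N 1 0 * P 1 0))
      + M 1 1 * M 1 1 * (q⁻¹ ^ 2 • (N 1 1 * P 1 1) - (1 - q⁻¹ ^ 2) • (N 1 0 * P 0 1))
      + M 1 0 * M 0 0 * ((N 0 0 * P 0 1) + (N 0 1 * P 0 0))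
      + M 0 1 * M 0 0 * (q ^ 4 • (N 0 0 * P 1 0) - q ^ 2 • (q ^ 2 - 1) • (N 1 1 * P 1 0)
        + (q ^ 6 - q ^ 4 + q ^ 2) • (N 1 0 * P 0 0) - q ^ 4 • (q ^ 2 - 1) • (N 1 0 * P 1 1))
      + M 0 1 * M 1 1 * ((N 1 1 * P 1 0) - (q ^ 2 - 1) • (N 1 0 * P 0 0) + q ^ 2
        • (N 1 0 * P 1 1))
      + M 1 0 * M 1 1 * ((N 1 1 * P 0 1) + q⁻¹ ^ 2 • (N 0 1 * P 1 1) - (1 - q⁻¹ ^ 2)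
        • (N 0 0 * P 0 1))
      + M 1 0 * M 0 1 * ((q ^ 2 - 1 + q⁻¹ ^ 2) • (N 1 0 * P 0 1) + (N 1 1 * P 0 0)
        + (N 0 0 * P 1 1) - (1 - q⁻¹ ^ 2) • (N 1 1 * P 1 1) - (1 - q⁻¹ ^ 2) • (N 0 0 * P 0 0)
        + q⁻¹ ^ 2 • (N 0 1 * P 1 0)) := by
  simp only [qTrace, Matrix.mul_apply, Fin.sum_univ_two, mul_add, add_mul, mul_sub, sub_mul,
    smul_add, smul_sub, smul_smul, smul_mul_assoc, mul_smul_comm, mul_assoc, mul_one, one_mul,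
    h.rules, hM.rules]
  match_scalars <;> field_simp <;> ring

/-- The combination of products of entries of `M₃ M₄`, `M₂ M₄` and of `M₄`, `M₂ M₃ M₄` that measures
the failure of the standard relation to hold entrywise. -/
def crossTerm (q : 𝕜) (M2 M3 M4 : Matrix (Fin 2) (Fin 2) W) (i j k l : Fin 2) : W :=
  q • ((M3 * M4) i j * (M2 * M4) k l) - q⁻¹ • ((M2 * M4) i j * (M3 * M4) k l)
    - (q - q⁻¹) • (M4 i j * (M2 * (M3 * M4)) k l)

-- These are the coefficients of the ten monomials of `IsReflection.qTrace_mul_qTrace`, with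
-- `crossTerm` in place of the products of entries of `N` and `P`. Only the constant coefficient
-- survives, and it is the part of the standard relation that does not involve `M₁`. The other nine
-- vanish, up to harmless scalar factors omitted here.
set_option maxHeartbeats 4000000 in
theorem crossTerm_relations (hq : q ≠ 0) (h4 : IsReflection q M4) (h23 : IsExchange q M2 M3)
    (h24 : IsExchange q M2 M4) (h34 : IsExchange q M3 M4) :
    letI X := crossTerm q M2 M3 M4
    (1 - q⁻¹ ^ 2) • X 1 0 0 1 + X 1 1 0 0 + X 0 0 1 1 = (q⁻¹ ^ 2 - q ^ 2) • qTrace q (M2 * M3)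
      + (q - q⁻¹) • (qTrace q M3 * qTrace q M2) ∧
    X 0 0 0 0 = 0 ∧
    X 0 1 0 1 = 0 ∧
    X 1 0 1 0 = 0 ∧
    q⁻¹ ^ 2 • X 1 1 1 1 - (1 - q⁻¹ ^ 2) • X 1 0 0 1 = 0 ∧
    X 0 0 0 1 + X 0 1 0 0 = 0 ∧
    q ^ 4 • X 0 0 1 0 - q ^ 2 • (q ^ 2 - 1) • X 1 1 1 0 + (q ^ 6 - q ^ 4 + q ^ 2) • X 1 0 0 0
      - q ^ 4 • (q ^ 2 - 1) • X 1 0 1 1 = 0 ∧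
    X 1 1 1 0 - (q ^ 2 - 1) • X 1 0 0 0 + q ^ 2 • X 1 0 1 1 = 0 ∧
    X 1 1 0 1 + q⁻¹ ^ 2 • X 0 1 1 1 - (1 - q⁻¹ ^ 2) • X 0 0 0 1 = 0 ∧
    (q ^ 2 - 1 + q⁻¹ ^ 2) • X 1 0 0 1 + X 1 1 0 0 + X 0 0 1 1 - (1 - q⁻¹ ^ 2) • X 1 1 1 1 - (1
      - q⁻¹ ^ 2) • X 0 0 0 0 + q⁻¹ ^ 2 • X 0 1 1 0 = 0 := by
  refine ⟨?_, ?_, ?_, ?_, ?_, ?_, ?_, ?_, ?_, ?_⟩ <;>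
  · simp only [crossTerm, qTrace, Matrix.mul_apply, Fin.sum_univ_two, mul_add, add_mul, mul_sub,
      sub_mul, smul_add, smul_sub, smul_smul, smul_mul_assoc, mul_smul_comm, mul_assoc, mul_one,
      one_mul, h23.rules, h24.rules, h34.rules, h4.rules]
    match_scalars <;> field_simp <;> ring

set_option maxHeartbeats 1000000 in
theorem qTrace_relation_shared_ends (hq : q ≠ 0) (h1 : IsReflection q M1) (h4 : IsReflection q M4)
    (h12 : IsExchange q M1 M2) (h13 : IsExchange q M1 M3) (h14 : IsExchange q M1 M4)
    (h23 : IsExchange q M2 M3) (h24 : IsExchange q M2 M4) (h34 : IsExchange q M3 M4) :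
    q • (qTrace q (M1 * M3 * M4) * qTrace q (M1 * M2 * M4))
        - q⁻¹ • (qTrace q (M1 * M2 * M4) * qTrace q (M1 * M3 * M4)) =
      (q⁻¹ ^ 2 - q ^ 2) • qTrace q (M2 * M3)
        + (q - q⁻¹) • (qTrace q (M1 * M4) * qTrace q (M1 * M2 * M3 * M4)
        + qTrace q M3 * qTrace q M2) := by
  -- With `M₁` in front, all three products of traces are instances of the same expansion, with `(N,
  -- P)` equal to `(M₃M₄, M₂M₄)`, `(M₂M₄, M₃M₄)` and `(M₄, M₂M₃M₄)`.
  simp only [mul_assoc M1, mul_assoc M2]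
  rw [h1.qTrace_mul_qTrace hq (h13.mul_right hq h14), h1.qTrace_mul_qTrace hq (h12.mul_right hq h14),
    h1.qTrace_mul_qTrace hq h14]
  obtain ⟨Hone, Haa, Hcc, Hbb, Hdd, Hca, Hba, Hbd, Hcd, Hcb⟩ :=
    crossTerm_relations hq h4 h23 h24 h34
  -- Each coefficient identity is multiplied by its monomial in `M₁`; `q ^ 2` and `q ^ 4` are the
  -- scalars carried by `M₀₀²` and `M₀₁²` in the expansion.
  linear_combination (norm := skip) Hone +
    q ^ 2 • (M1 0 0 * M1 0 0 * Haa) +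
    M1 1 0 * M1 1 0 * Hcc +
    q ^ 4 • (M1 0 1 * M1 0 1 * Hbb) +
    M1 1 1 * M1 1 1 * Hdd +
    M1 1 0 * M1 0 0 * Hca +
    M1 0 1 * M1 0 0 * Hba +
    M1 0 1 * M1 1 1 * Hbd +
    M1 1 0 * M1 1 1 * Hcd +
    M1 1 0 * M1 0 1 * Hcb
  simp only [crossTerm, mul_add, mul_sub, smul_add, smul_sub, smul_smul, mul_smul_comm, mul_zero]
  module

end LoopAlgebra

/-! ### The trace identities when one inner block is shared -/

section LoopAlgebra

variable {𝕜 W : Type*} [Field 𝕜] [Ring W] [Algebra 𝕜 W] {q : 𝕜}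
  {M N M1 M2 M3 M4 : Matrix (Fin 2) (Fin 2) W}

/-- This is the standard relation with one trace left open: multiplying by a matrix on either side
and taking the quantum trace closes it. The identity matrix marks where `M` has disappeared from
between its neighbours. -/
theorem IsReflection.entry_mul_qTrace (hq : q ≠ 0) (hM : IsReflection q M)
    (h : IsExchange q M N) (i j : Fin 2) :
    q • (M i j * qTrace q (M * N)) - q⁻¹ • (qTrace q (M * N) * M i j) =
      (q⁻¹ ^ 2 - q ^ 2) • N i j + (q - q⁻¹) • (qTrace q M * (M * N) i j
        + qTrace q N * (1 : Matrix (Fin 2) (Fin 2) W) i j) := by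
  fin_cases i <;> fin_cases j <;>
  · simp only [Fin.zero_eta, Fin.mk_one, Fin.isValue, Matrix.one_apply_eq, ne_eq, zero_ne_one,
      one_ne_zero, not_false_eq_true, Matrix.one_apply_ne, mul_zero, add_zero, qTrace,
      Matrix.mul_apply, Fin.sum_univ_two, mul_add, add_mul, mul_sub, sub_mul, smul_add,
      smul_sub, smul_smul, smul_mul_assoc, mul_smul_comm, mul_assoc, mul_one, one_mul, hM.rules,
      h.rules]
    match_scalars <;> field_simp <;> ring

theorem IsReflection.qTrace_mul_entry (hq : q ≠ 0) (hN : IsReflection q N)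
    (h : IsExchange q M N) (i j : Fin 2) :
    q • (qTrace q (M * N) * N i j) - q⁻¹ • (N i j * qTrace q (M * N)) =
      (q⁻¹ ^ 2 - q ^ 2) • M i j + (q - q⁻¹) • (qTrace q N * (M * N) i j
        + qTrace q M * (1 : Matrix (Fin 2) (Fin 2) W) i j) := by
  fin_cases i <;> fin_cases j <;>
  · simp only [Fin.zero_eta, Fin.mk_one, Fin.isValue, Matrix.one_apply_eq, ne_eq, zero_ne_one,
      one_ne_zero, not_false_eq_true, Matrix.one_apply_ne, mul_zero, add_zero, qTrace,
      Matrix.mul_apply, Fin.sum_univ_two, mul_add, add_mul, mul_sub, sub_mul, smul_add,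
      smul_sub, smul_smul, smul_mul_assoc, mul_smul_comm, mul_assoc, mul_one, one_mul, hN.rules,
      h.rules]
    match_scalars <;> field_simp <;> ring

/-- The open relation for `M₂`, `M₃` is placed between `M₁` and `M₄`. The trace of `M₂M₃` commutes
with the entries of both outer matrices, that of `M₂` with those of `M₁`, and that of `M₃` with
those of `M₄`. -/
theorem qTrace_relation_shared_second (hq : q ≠ 0) (h2 : IsReflection q M2)
    (h12 : IsExchange q M1 M2) (h13 : IsExchange q M1 M3) (h23 : IsExchange q M2 M3)
    (h24 : IsExchange q M2 M4) (h34 : IsExchange q M3 M4) :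
    q • (qTrace q (M1 * M2 * M4) * qTrace q (M2 * M3))
        - q⁻¹ • (qTrace q (M2 * M3) * qTrace q (M1 * M2 * M4)) =
      (q⁻¹ ^ 2 - q ^ 2) • qTrace q (M1 * M3 * M4)
        + (q - q⁻¹) • (qTrace q M2 * qTrace q (M1 * M2 * M3 * M4)
        + qTrace q (M1 * M4) * qTrace q M3) := by
  have H := h2.entry_mul_qTrace hq h23
  have c1 := fun i j => ((h12.mul_right hq h13).commute_qTrace_right hq i j).eq
  have c4 := fun i j => ((h24.mul_left hq h34).commute_qTrace_left hq i j).eq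
  have d1 := fun i j => (h12.commute_qTrace_right hq i j).eq
  have e4 := fun i j => (h34.commute_qTrace_left hq i j).eq
  rw [mul_assoc M1 M2 M3]
  -- From here on the inner product and the three traces are opaque; only their commutation with the
  -- outer entries matters.
  generalize M2 * M3 = P at *
  generalize qTrace q P = T at *
  generalize qTrace q M2 = t2 at *
  generalize qTrace q M3 = t3 at *
  -- This is the quantum trace of `M₁ H M₄`, written out.
  linear_combination (norm := skip) q • (M1 0 0 * H 0 0 * M4 0 0 + M1 0 0 * H 0 1 * M4 1 0 + M1 0 1 * H 1 0 * M4 0 0 + M1 0 1 * H 1 1 * M4 1 0) +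
    q⁻¹ • (M1 1 0 * H 0 0 * M4 0 1 + M1 1 0 * H 0 1 * M4 1 1 + M1 1 1 * H 1 0 * M4 0 1 + M1 1 1 * H 1 1 * M4 1 1)
  simp only [qTrace, Fin.isValue, Matrix.one_apply_eq, ne_eq, zero_ne_one,
    one_ne_zero, not_false_eq_true, Matrix.one_apply_ne, mul_zero, add_zero,
    Matrix.mul_apply, Fin.sum_univ_two, mul_add, add_mul, mul_sub, sub_mul, smul_add,
    smul_sub, smul_smul, smul_mul_assoc, mul_smul_comm, mul_assoc, mul_one, c4, e4,
    fun i j => mul_mul_of_mul_eq (c1 i j), fun i j => mul_mul_of_mul_eq (d1 i j)]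
  module

theorem qTrace_relation_shared_third (hq : q ≠ 0) (h3 : IsReflection q M3)
    (h12 : IsExchange q M1 M2) (h13 : IsExchange q M1 M3) (h23 : IsExchange q M2 M3)
    (h24 : IsExchange q M2 M4) (h34 : IsExchange q M3 M4) :
    q • (qTrace q (M2 * M3) * qTrace q (M1 * M3 * M4))
        - q⁻¹ • (qTrace q (M1 * M3 * M4) * qTrace q (M2 * M3)) =
      (q⁻¹ ^ 2 - q ^ 2) • qTrace q (M1 * M2 * M4)
        + (q - q⁻¹) • (qTrace q M3 * qTrace q (M1 * M2 * M3 * M4)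
        + qTrace q M2 * qTrace q (M1 * M4)) := by
  have H := h3.qTrace_mul_entry hq h23
  have c1 := fun i j => ((h12.mul_right hq h13).commute_qTrace_right hq i j).eq
  have c4 := fun i j => ((h24.mul_left hq h34).commute_qTrace_left hq i j).eq
  have d1 := fun i j => (h12.commute_qTrace_right hq i j).eq
  have e1 := fun i j => (h13.commute_qTrace_right hq i j).eq
  rw [mul_assoc M1 M2 M3]
  generalize M2 * M3 = P at *
  generalize qTrace q P = T at *
  generalize qTrace q M2 = t2 at *
  generalize qTrace q M3 = t3 at *
  linear_combination (norm := skip) q • (M1 0 0 * H 0 0 * M4 0 0 + M1 0 0 * H 0 1 * M4 1 0 + M1 0 1 * H 1 0 * M4 0 0 + M1 0 1 * H 1 1 * M4 1 0) +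
    q⁻¹ • (M1 1 0 * H 0 0 * M4 0 1 + M1 1 0 * H 0 1 * M4 1 1 + M1 1 1 * H 1 0 * M4 0 1 + M1 1 1 * H 1 1 * M4 1 1)
  simp only [qTrace, Fin.isValue, Matrix.one_apply_eq, ne_eq, zero_ne_one,
    one_ne_zero, not_false_eq_true, Matrix.one_apply_ne, mul_zero, add_zero,
    Matrix.mul_apply, Fin.sum_univ_two, mul_add, add_mul, mul_sub, sub_mul, smul_add,
    smul_sub, smul_smul, smul_mul_assoc, mul_smul_comm, mul_assoc, mul_one, c4,
    fun i j => mul_mul_of_mul_eq (c1 i j), fun i j => mul_mul_of_mul_eq (d1 i j),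
    fun i j => mul_mul_of_mul_eq (e1 i j)]
  module

end LoopAlgebra

/-! ### The matrix `L` and its conjugation by a Borel matrix -/

section LoopAlgebra

variable {𝕜 W : Type*} [Field 𝕜] [Ring W] [Algebra 𝕜 W]

/-- Elements that satisfy the defining relations of `U_q(sl₂)`. -/
structure IsQuantumSl2 (q : 𝕜) (E F K k : W) : Prop where
  Kk : K * k = 1
  kK : k * K = 1
  EK : E * K = q⁻¹ ^ 2 • (K * E)
  Ek : E * k = q ^ 2 • (k * E)
  KF : K * F = q⁻¹ ^ 2 • (F * K)
  kF : k * F = q ^ 2 • (F * k)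
  EF : E * F = F * E + (q - q⁻¹)⁻¹ • (K - k)

/-- The solution of the reflection equation attached to `U_q(sl₂)`. -/
def lMatrix (q : 𝕜) (E F K k : W) : Matrix (Fin 2) (Fin 2) W :=
  !![k, (q * (q - q⁻¹) ^ 2) • F;
    E * k, q • ((q - q⁻¹) ^ 2 • (E * F) + q⁻¹ • K + q • k) - q ^ 2 • k]

/-- The conjugate of `M` by an upper triangular matrix with entries in the Borel subalgebra
generated by `F` and `K`, whose inverse is `k`. -/
def twist (q : 𝕜) (F K k : W) (M : Matrix (Fin 2) (Fin 2) W) : Matrix (Fin 2) (Fin 2) W :=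
  !![1, -(q⁻¹ * (q - q⁻¹) ^ 2) • F; 0, k] * M * !![1, (q⁻¹ * (q - q⁻¹) ^ 2) • (F * K); 0, K]

variable {q : 𝕜} {E F K k : W} {M N : Matrix (Fin 2) (Fin 2) W}

theorem IsQuantumSl2.rules (h : IsQuantumSl2 q E F K k) :
    (K * k = 1) ∧ (k * K = 1) ∧ (E * K = q⁻¹ ^ 2 • (K * E)) ∧ (E * k = q ^ 2 • (k * E)) ∧
    (K * F = q⁻¹ ^ 2 • (F * K)) ∧ (k * F = q ^ 2 • (F * k)) ∧
    (E * F = F * E + (q - q⁻¹)⁻¹ • (K - k)) ∧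
    (∀ w, K * (k * w) = 1 * w) ∧ (∀ w, k * (K * w) = 1 * w) ∧
    (∀ w, E * (K * w) = (q⁻¹ ^ 2 • (K * E)) * w) ∧ (∀ w, E * (k * w) = (q ^ 2 • (k * E)) * w) ∧
    (∀ w, K * (F * w) = (q⁻¹ ^ 2 • (F * K)) * w) ∧ (∀ w, k * (F * w) = (q ^ 2 • (F * k)) * w) ∧
    (∀ w, E * (F * w) = (F * E + (q - q⁻¹)⁻¹ • (K - k)) * w) :=
  ⟨h.Kk, h.kK, h.EK, h.Ek, h.KF, h.kF, h.EF, mul_mul_of_mul_eq h.Kk, mul_mul_of_mul_eq h.kK,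
    mul_mul_of_mul_eq h.EK, mul_mul_of_mul_eq h.Ek, mul_mul_of_mul_eq h.KF,
    mul_mul_of_mul_eq h.kF, mul_mul_of_mul_eq h.EF⟩

theorem sub_inv_eq_div (hq : q ≠ 0) : q - q⁻¹ = (q ^ 2 - 1) / q := by
  field_simp

theorem IsQuantumSl2.isReflection_lMatrix (hq : q ≠ 0) (hs : q - q⁻¹ ≠ 0)
    (h : IsQuantumSl2 q E F K k) : IsReflection q (lMatrix q E F K k) := by
  have hs' : q ^ 2 - 1 ≠ 0 := fun h => hs (by rw [sub_inv_eq_div hq, h, zero_div])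
  constructor <;>
  · simp only [lMatrix, Matrix.of_apply, Matrix.cons_val', Matrix.cons_val_zero,
      Matrix.cons_val_one, Matrix.cons_val_fin_one, mul_add, add_mul, mul_sub, sub_mul, smul_add,
      smul_sub, smul_smul, smul_mul_assoc, mul_smul_comm, mul_assoc, mul_one, one_mul, h.rules]
    match_scalars <;> field_simp <;> ring

/-- Three elements commute with the entries of a matrix. -/
structure CommutesWith (F K k : W) (M : Matrix (Fin 2) (Fin 2) W) : Prop where
  mul_F : ∀ i j, M i j * F = F * M i j
  mul_K : ∀ i j, M i j * K = K * M i j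
  mul_k : ∀ i j, M i j * k = k * M i j

theorem CommutesWith.rules (h : CommutesWith F K k M) :
    (∀ i j, M i j * F = F * M i j) ∧ (∀ i j, M i j * K = K * M i j) ∧
    (∀ i j, M i j * k = k * M i j) ∧ (∀ i j w, M i j * (F * w) = (F * M i j) * w) ∧
    (∀ i j w, M i j * (K * w) = (K * M i j) * w) ∧
    (∀ i j w, M i j * (k * w) = (k * M i j) * w) :=
  ⟨h.mul_F, h.mul_K, h.mul_k, fun i j => mul_mul_of_mul_eq (h.mul_F i j),
    fun i j => mul_mul_of_mul_eq (h.mul_K i j), fun i j => mul_mul_of_mul_eq (h.mul_k i j)⟩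

theorem IsQuantumSl2.twist_apply (hq : q ≠ 0) (h : IsQuantumSl2 q E F K k)
    (hM : CommutesWith F K k M) :
    twist q F K k M 0 0 = M 0 0 - (q⁻¹ * (q - q⁻¹) ^ 2) • (F * M 1 0) ∧
    twist q F K k M 0 1 = K * M 0 1 + (q⁻¹ * (q - q⁻¹) ^ 2) • (F * (K * (M 0 0 - M 1 1)))
      - (q⁻¹ ^ 2 * (q - q⁻¹) ^ 4) • (F * (F * (K * M 1 0))) ∧
    twist q F K k M 1 0 = k * M 1 0 ∧
    twist q F K k M 1 1 = M 1 1 + (q * (q - q⁻¹) ^ 2) • (F * M 1 0) := by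
  refine ⟨?_, ?_, ?_, ?_⟩ <;>
  · simp only [twist, Matrix.mul_apply, Fin.sum_univ_two, Matrix.of_apply, Matrix.cons_val',
      Matrix.cons_val_zero, Matrix.cons_val_one, Matrix.cons_val_fin_one, add_mul,
      mul_sub, smul_sub, smul_smul, smul_mul_assoc, mul_smul_comm, mul_assoc,
      mul_one, one_mul, mul_zero, zero_mul, h.rules, hM.rules]
    match_scalars <;> field_simp

/-- The two outer matrices in `twist` are mutually inverse, so the inner pair cancels. No
commutation of `F`, `K`, `k` with the entries of `M` and `N` is required. -/
theorem IsQuantumSl2.twist_mul (h : IsQuantumSl2 q E F K k) :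
    twist q F K k (M * N) = twist q F K k M * twist q F K k N := by
  have key : !![1, (q⁻¹ * (q - q⁻¹) ^ 2) • (F * K); 0, K] *
      !![1, -(q⁻¹ * (q - q⁻¹) ^ 2) • F; 0, k] = (1 : Matrix (Fin 2) (Fin 2) W) := by
    rw [Matrix.mul_fin_two, Matrix.one_fin_two]
    simp [mul_assoc, h.Kk]
  unfold twist
  simp only [mul_assoc]
  rw [← mul_assoc !![1, (q⁻¹ * (q - q⁻¹) ^ 2) • (F * K); 0, K], key, one_mul]

theorem IsQuantumSl2.twist_one (h : IsQuantumSl2 q E F K k) :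
    twist q F K k (1 : Matrix (Fin 2) (Fin 2) W) = 1 := by
  rw [twist, mul_one, Matrix.mul_fin_two, Matrix.one_fin_two]
  simp [h.kK]

/-- The diagonal corrections are multiples of `F * M 1 0`, and they cancel under the weights `q`,
`q⁻¹`. This is the matrix form of `τ_R(Λ) = 1 ⊗ Λ`. -/
theorem IsQuantumSl2.qTrace_twist (hq : q ≠ 0) (h : IsQuantumSl2 q E F K k)
    (hM : CommutesWith F K k M) : qTrace q (twist q F K k M) = qTrace q M := by
  obtain ⟨h1, -, -, h2⟩ := h.twist_apply hq hM
  rw [qTrace, h1, h2, qTrace]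
  match_scalars <;> field_simp
  all_goals ring

set_option maxHeartbeats 1000000 in
theorem IsQuantumSl2.isReflection_twist (hq : q ≠ 0) (h : IsQuantumSl2 q E F K k)
    (hM : CommutesWith F K k M) (hR : IsReflection q M) : IsReflection q (twist q F K k M) := by
  obtain ⟨h1, h2, h3, h4⟩ := h.twist_apply hq hM
  constructor <;>
  · simp only [h1, h2, h3, h4, mul_add, add_mul, mul_sub, sub_mul, smul_add, smul_sub, smul_smul,
      smul_mul_assoc, mul_smul_comm, mul_assoc, mul_one, one_mul, h.rules, hM.rules, hR.rules]
    all_goals (match_scalars <;> field_simp <;> ring)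

set_option maxHeartbeats 1000000 in
theorem IsQuantumSl2.isExchange_twist (hq : q ≠ 0) (h : IsQuantumSl2 q E F K k)
    (hM : CommutesWith F K k M) (hN : CommutesWith F K k N) (hR : IsExchange q M N) :
    IsExchange q (twist q F K k M) (twist q F K k N) := by
  obtain ⟨h1, h2, h3, h4⟩ := h.twist_apply hq hM
  obtain ⟨h1', h2', h3', h4'⟩ := h.twist_apply hq hN
  constructor <;>
  · simp only [h1, h2, h3, h4, h1', h2', h3', h4', mul_add, add_mul, mul_sub, sub_mul, smul_add,
      smul_sub, smul_smul, smul_mul_assoc, mul_smul_comm, mul_assoc, mul_one, one_mul, h.rules,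
      hM.rules, hN.rules, hR.rules]
    all_goals (match_scalars <;> field_simp <;> ring)

-- The entries of `N` need satisfy no relations among themselves: they commute with `E`, `F`, `K`,
-- `k`, and the conjugation alone turns this commutation into the exchange relations. All exchange
-- relations between different positions originate here.
set_option maxHeartbeats 1000000 in
theorem IsQuantumSl2.isExchange_lMatrix_twist (hq : q ≠ 0) (hs : q - q⁻¹ ≠ 0)
    (h : IsQuantumSl2 q E F K k) (hN : CommutesWith F K k N) (hE : ∀ i j, N i j * E = E * N i j) :
    IsExchange q (lMatrix q E F K k) (twist q F K k N) := by
  have hs' : q ^ 2 - 1 ≠ 0 := fun h => hs (by rw [sub_inv_eq_div hq, h, zero_div])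
  obtain ⟨h1, h2, h3, h4⟩ := h.twist_apply hq hN
  constructor <;>
  · simp only [lMatrix, Matrix.of_apply, Matrix.cons_val', Matrix.cons_val_zero,
      Matrix.cons_val_one, Matrix.cons_val_fin_one, h1, h2, h3, h4, mul_add, add_mul, mul_sub,
      sub_mul, smul_add, smul_sub, smul_smul, smul_mul_assoc, mul_smul_comm, mul_assoc, mul_one,
      one_mul, h.rules, hN.rules, hE]
    all_goals (match_scalars <;> field_simp <;> ring)

end LoopAlgebra

/-! ### Monodromy matrices in tensor powers -/

section TensorPowers

universe u

variable {𝕜 : Type u} [Field 𝕜] (q : 𝕜ˣ)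

theorem NotRootOfUnity.sub_inv_ne_zero {q : 𝕜ˣ} (hq : NotRootOfUnity q) :
    (q : 𝕜) - (q : 𝕜)⁻¹ ≠ 0 := by
  intro h
  apply hq 2 two_pos
  ext
  have := congrArg (fun t => (q : 𝕜) * t) (sub_eq_zero.1 h)
  simpa [pow_two] using this

theorem isQuantumSl2_gen : IsQuantumSl2 (q : 𝕜) (genE q) (genF q) (genK q) (genKinv q) where
  Kk := K_mul_Kinv q
  kK := Kinv_mul_K q
  EK := E_mul_K q
  Ek := E_mul_Kinv q
  KF := K_mul_F q
  kF := Kinv_mul_F q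
  EF := E_mul_F q

variable {W : Type*} [Ring W] [Algebra 𝕜 W]

theorem IsQuantumSl2.map {V : Type*} [Ring V] [Algebra 𝕜 V] {q : 𝕜} {E F K k : V}
    (h : IsQuantumSl2 q E F K k) (φ : V →ₐ[𝕜] W) : IsQuantumSl2 q (φ E) (φ F) (φ K) (φ k) where
  Kk := by rw [← map_mul, h.Kk, map_one]
  kK := by rw [← map_mul, h.kK, map_one]
  EK := by rw [← map_mul, h.EK, map_smul, map_mul]
  Ek := by rw [← map_mul, h.Ek, map_smul, map_mul]
  KF := by rw [← map_mul, h.KF, map_smul, map_mul]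
  kF := by rw [← map_mul, h.kF, map_smul, map_mul]
  EF := by rw [← map_mul, h.EF, map_add, map_mul, map_smul, map_sub]

theorem IsReflection.map {V : Type*} [Ring V] [Algebra 𝕜 V] {q : 𝕜}
    {M : Matrix (Fin 2) (Fin 2) V} (h : IsReflection q M) (φ : V →ₐ[𝕜] W) :
    IsReflection q (M.map φ) := by
  constructor <;>
  · simp only [Matrix.map_apply, ← map_mul, h.rules]
    simp only [map_add, map_sub, map_smul, map_one, map_mul]

theorem IsExchange.map {V : Type*} [Ring V] [Algebra 𝕜 V] {q : 𝕜}
    {M N : Matrix (Fin 2) (Fin 2) V} (h : IsExchange q M N) (φ : V →ₐ[𝕜] W) :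
    IsExchange q (M.map φ) (N.map φ) := by
  constructor <;>
  · simp only [Matrix.map_apply, ← map_mul, h.rules]
    try simp only [map_add, map_sub, map_smul, map_mul]

theorem tmul_isQuantumSl2 : IsQuantumSl2 (q : 𝕜) (genE q ⊗ₜ[𝕜] (1 : W)) (genF q ⊗ₜ[𝕜] (1 : W))
    (genK q ⊗ₜ[𝕜] (1 : W)) (genKinv q ⊗ₜ[𝕜] (1 : W)) :=
  (isQuantumSl2_gen q).map
    (Algebra.TensorProduct.includeLeft : Uq q →ₐ[𝕜] Uq q ⊗[𝕜] W)

/-- The matrix `1 ⊗ M`. -/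
def inclRightMat (M : Matrix (Fin 2) (Fin 2) W) : Matrix (Fin 2) (Fin 2) (Uq q ⊗[𝕜] W) :=
  M.map (Algebra.TensorProduct.includeRight : W →ₐ[𝕜] Uq q ⊗[𝕜] W)

theorem inclRightMat_commutesWith (M : Matrix (Fin 2) (Fin 2) W) :
    CommutesWith (genF q ⊗ₜ[𝕜] (1 : W)) (genK q ⊗ₜ[𝕜] (1 : W)) (genKinv q ⊗ₜ[𝕜] (1 : W))
      (inclRightMat q M) := by
  constructor <;> intro i j <;> simp [inclRightMat]

/-- The morphism `τ_R`, extended to matrices with entries in an algebra. -/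
def tensorTwist (M : Matrix (Fin 2) (Fin 2) W) : Matrix (Fin 2) (Fin 2) (Uq q ⊗[𝕜] W) :=
  twist (q : 𝕜) (genF q ⊗ₜ[𝕜] (1 : W)) (genK q ⊗ₜ[𝕜] (1 : W)) (genKinv q ⊗ₜ[𝕜] (1 : W))
    (inclRightMat q M)

/-- The matrix `L ⊗ 1`. -/
def tensorL (W : Type*) [Ring W] [Algebra 𝕜 W] : Matrix (Fin 2) (Fin 2) (Uq q ⊗[𝕜] W) :=
  lMatrix (q : 𝕜) (genE q ⊗ₜ[𝕜] (1 : W)) (genF q ⊗ₜ[𝕜] (1 : W)) (genK q ⊗ₜ[𝕜] (1 : W))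
    (genKinv q ⊗ₜ[𝕜] (1 : W))

theorem tensorTwist_mul (M N : Matrix (Fin 2) (Fin 2) W) :
    tensorTwist q (M * N) = tensorTwist q M * tensorTwist q N := by
  rw [tensorTwist, inclRightMat, Matrix.map_mul]
  exact (tmul_isQuantumSl2 q).twist_mul

theorem tensorTwist_one : tensorTwist q (1 : Matrix (Fin 2) (Fin 2) W) = 1 := by
  rw [tensorTwist, inclRightMat, Matrix.map_one _ (map_zero _) (map_one _)]
  exact (tmul_isQuantumSl2 q).twist_one

theorem qTrace_tensorTwist (M : Matrix (Fin 2) (Fin 2) W) :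
    qTrace (q : 𝕜) (tensorTwist q M) = 1 ⊗ₜ qTrace (q : 𝕜) M := by
  rw [tensorTwist, (tmul_isQuantumSl2 q).qTrace_twist q.ne_zero (inclRightMat_commutesWith q M)]
  simp [qTrace, inclRightMat, TensorProduct.tmul_add]

theorem tensorTwist_apply (M : Matrix (Fin 2) (Fin 2) W) :
    tensorTwist q M 0 0 = 1 ⊗ₜ M 0 0
      - ((q : 𝕜)⁻¹ * ((q : 𝕜) - (q : 𝕜)⁻¹) ^ 2) • (genF q ⊗ₜ M 1 0) ∧
    tensorTwist q M 0 1 = genK q ⊗ₜ M 0 1 + ((q : 𝕜)⁻¹ * ((q : 𝕜) - (q : 𝕜)⁻¹) ^ 2) •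
        ((genF q * genK q) ⊗ₜ (M 0 0 - M 1 1))
      - ((q : 𝕜)⁻¹ ^ 2 * ((q : 𝕜) - (q : 𝕜)⁻¹) ^ 4) •
        ((genF q * (genF q * genK q)) ⊗ₜ M 1 0) ∧
    tensorTwist q M 1 0 = genKinv q ⊗ₜ M 1 0 ∧
    tensorTwist q M 1 1 = 1 ⊗ₜ M 1 1
      + ((q : 𝕜) * ((q : 𝕜) - (q : 𝕜)⁻¹) ^ 2) • (genF q ⊗ₜ M 1 0) := by
  have h := (tmul_isQuantumSl2 q).twist_apply q.ne_zero (inclRightMat_commutesWith q M)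
  simpa only [tensorTwist, inclRightMat, Matrix.map_apply,
    Algebra.TensorProduct.includeRight_apply, ← TensorProduct.tmul_sub,
    Algebra.TensorProduct.tmul_mul_tmul, one_mul, mul_one] using h

theorem tensorL_apply :
    tensorL q W 0 0 = genKinv q ⊗ₜ 1 ∧
    tensorL q W 0 1 = ((q : 𝕜) * ((q : 𝕜) - (q : 𝕜)⁻¹) ^ 2) • (genF q ⊗ₜ 1) ∧
    tensorL q W 1 0 = (genE q * genKinv q) ⊗ₜ 1 ∧
    tensorL q W 1 1 = (q : 𝕜) • (casimir q ⊗ₜ 1) - (q : 𝕜) ^ 2 • (genKinv q ⊗ₜ 1) := by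
  simp only [tensorL, lMatrix, Matrix.of_apply, Matrix.cons_val', Matrix.cons_val_zero,
    Matrix.cons_val_one, Matrix.cons_val_fin_one, Algebra.TensorProduct.tmul_mul_tmul, mul_one,
    casimir, TensorProduct.add_tmul, TensorProduct.smul_tmul', and_self]

variable {q} {M N : Matrix (Fin 2) (Fin 2) W}

theorem IsReflection.tensorTwist (h : IsReflection (q : 𝕜) M) :
    IsReflection (q : 𝕜) (tensorTwist q M) :=
  (tmul_isQuantumSl2 q).isReflection_twist q.ne_zero (inclRightMat_commutesWith q M) (h.map _)

theorem IsExchange.tensorTwist (h : IsExchange (q : 𝕜) M N) :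
    IsExchange (q : 𝕜) (tensorTwist q M) (tensorTwist q N) :=
  (tmul_isQuantumSl2 q).isExchange_twist q.ne_zero (inclRightMat_commutesWith q M)
    (inclRightMat_commutesWith q N) (h.map _)

theorem isExchange_tensorL_tensorTwist (hs : (q : 𝕜) - (q : 𝕜)⁻¹ ≠ 0)
    (N : Matrix (Fin 2) (Fin 2) W) : IsExchange (q : 𝕜) (tensorL q W) (tensorTwist q N) :=
  (tmul_isQuantumSl2 q).isExchange_lMatrix_twist q.ne_zero hs (inclRightMat_commutesWith q N)
    (fun i j => by simp [inclRightMat])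

theorem isReflection_tensorL (hs : (q : 𝕜) - (q : 𝕜)⁻¹ ≠ 0) :
    IsReflection (q : 𝕜) (tensorL q W) :=
  (tmul_isQuantumSl2 q).isReflection_lMatrix q.ne_zero hs

variable (q)

open Classical in
/-- One step of the recursion for the monodromy matrix: multiplication by `L` in the first tensor
factor if `p` holds. -/
noncomputable def monodromyStep (p : Prop) (M : Matrix (Fin 2) (Fin 2) W) :
    Matrix (Fin 2) (Fin 2) (Uq q ⊗[𝕜] W) :=
  (if p then tensorL q W else 1) * tensorTwist q M

/-- The ordered product of the dressed matrices `L` over the positions `i < n` with `a + i ∈ A`. -/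
noncomputable def monodromy (A : Finset ℕ) : (n a : ℕ) → Matrix (Fin 2) (Fin 2) (tensorPow q n)
  | 0, _ => 1
  | n + 1, a => (monodromyStep q (a ∈ A) (monodromy A n (a + 1)) :
      Matrix (Fin 2) (Fin 2) (Uq q ⊗[𝕜] tensorPow q n))

variable {q}

theorem isReflection_monodromy (hs : (q : 𝕜) - (q : 𝕜)⁻¹ ≠ 0) (A : Finset ℕ) (n a : ℕ) :
    IsReflection (q : 𝕜) (monodromy q A n a) := by
  induction n generalizing a with
  | zero => exact IsReflection.one
  | succ n ih =>
    change IsReflection (q : 𝕜) (monodromyStep q (a ∈ A) (monodromy q A n (a + 1)))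
    rw [monodromyStep]
    split_ifs
    -- `L` in the new factor exchanges with any twisted matrix, so the product criterion applies.
    · exact (isReflection_tensorL hs).mul q.ne_zero (ih _).tensorTwist
        (isExchange_tensorL_tensorTwist hs _)
    · rw [one_mul]
      exact (ih _).tensorTwist

theorem monodromy_eq_one {A : Finset ℕ} {a : ℕ} (h : ∀ x ∈ A, x < a) (n : ℕ) :
    monodromy q A n a = 1 := by
  induction n generalizing a with
  | zero => rfl
  | succ n ih =>
    change monodromyStep q (a ∈ A) (monodromy q A n (a + 1)) = 1
    rw [monodromyStep, if_neg fun ha => lt_irrefl a (h a ha), one_mul,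
      ih fun x hx => (h x hx).trans a.lt_succ_self, tensorTwist_one]

theorem isExchange_monodromy (hs : (q : 𝕜) - (q : 𝕜)⁻¹ ≠ 0) {A B : Finset ℕ}
    (h : ∀ x ∈ A, ∀ y ∈ B, x < y) (n a : ℕ) :
    IsExchange (q : 𝕜) (monodromy q A n a) (monodromy q B n a) := by
  induction n generalizing a with
  | zero => exact IsExchange.one_left
  | succ n ih =>
    -- If `a ∈ B`, all of `A` lies before `a` and its matrix is trivial. Otherwise only `A` can
    -- contribute a factor `L` at `a`, and that factor stands on the left, as the order requires.
    by_cases hB : a ∈ B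
    · rw [monodromy_eq_one fun x hx => h x hx a hB]
      exact IsExchange.one_left
    · change IsExchange (q : 𝕜) (monodromyStep q (a ∈ A) (monodromy q A n (a + 1)))
        (monodromyStep q (a ∈ B) (monodromy q B n (a + 1)))
      rw [monodromyStep, monodromyStep, if_neg hB, one_mul]
      split_ifs
      · exact (isExchange_tensorL_tensorTwist hs _).mul_left q.ne_zero (ih _).tensorTwist
      · rw [one_mul]
        exact (ih _).tensorTwist

theorem monodromy_union {A B : Finset ℕ} (h : ∀ x ∈ A, ∀ y ∈ B, x < y) (n a : ℕ) :
    monodromy q (A ∪ B) n a = monodromy q A n a * monodromy q B n a := by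
  induction n generalizing a with
  | zero => exact (one_mul _).symm
  | succ n ih =>
    change monodromyStep q _ (monodromy q (A ∪ B) n (a + 1)) =
      monodromyStep q _ (monodromy q A n (a + 1)) * monodromyStep q _ (monodromy q B n (a + 1))
    by_cases hB : a ∈ B
    · have hA : ∀ x ∈ A, x < a := fun x hx => h x hx a hB
      rw [ih, monodromy_eq_one fun x hx => (hA x hx).trans a.lt_succ_self, one_mul]
      simp only [monodromyStep]
      rw [if_pos (Finset.mem_union_right _ hB), if_neg fun ha => lt_irrefl a (hA a ha),
        tensorTwist_one, one_mul, one_mul, if_pos hB]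
    · rw [ih]
      by_cases hA : a ∈ A
      · rw [monodromyStep, monodromyStep, monodromyStep, if_pos hA, if_neg hB, one_mul,
          if_pos (Finset.mem_union_left _ hA), tensorTwist_mul, mul_assoc]
      · rw [monodromyStep, monodromyStep, monodromyStep, if_neg hA, if_neg hB, one_mul, one_mul,
          if_neg (by simp [hA, hB]), tensorTwist_mul, one_mul]

end TensorPowers

/-! ### The right extension process computes a quantum trace -/

section Extension

universe u

variable {𝕜 : Type u} [Field 𝕜] (q : 𝕜ˣ)

/-- The matrix `L` with entries in `I_R`. -/
noncomputable def irL : Matrix (Fin 2) (Fin 2) (IR q) :=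
  !![irKinv q, ((q : 𝕜) * ((q : 𝕜) - (q : 𝕜)⁻¹) ^ 2) • irF q;
    irE q, (q : 𝕜) • irCas q - (q : 𝕜) ^ 2 • irKinv q]

theorem irL_apply : irL q 0 0 = irKinv q ∧
    irL q 0 1 = ((q : 𝕜) * ((q : 𝕜) - (q : 𝕜)⁻¹) ^ 2) • irF q ∧ irL q 1 0 = irE q ∧
    irL q 1 1 = (q : 𝕜) • irCas q - (q : 𝕜) ^ 2 • irKinv q := by
  simp [irL]

theorem qTrace_irL : qTrace (q : 𝕜) (irL q) = irCas q := by
  have hq : (q : 𝕜) ≠ 0 := q.ne_zero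
  obtain ⟨h1, -, -, h2⟩ := irL_apply q
  rw [qTrace, h1, h2]
  match_scalars <;> field_simp
  ring

theorem tensorL_eq (W : Type*) [Ring W] [Algebra 𝕜 W] (i j : Fin 2) :
    tensorL q W i j = (irL q i j : Uq q) ⊗ₜ 1 := by
  obtain ⟨h1, h2, h3, h4⟩ := tensorL_apply q (W := W)
  obtain ⟨l1, l2, l3, l4⟩ := irL_apply q
  fin_cases i <;> fin_cases j
  · simp [h1, l1, irKinv]
  · simp [h2, l2, irF, TensorProduct.smul_tmul']
  · simp [h3, l3, irE]
  · simp [h4, l4, irCas, irKinv, TensorProduct.smul_tmul', TensorProduct.sub_tmul]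

/-- The prescribed values of `τ_R` on generators, including the long formula for `τ_R(F)`, are the
entries of one conjugated matrix. -/
theorem tauR_irL (hq : NotRootOfUnity q) (i j : Fin 2) :
    tauR q hq (irL q i j) = tensorTwist q (irL q) i j := by
  have hq0 : (q : 𝕜) ≠ 0 := q.ne_zero
  obtain ⟨t1, t2, t3, t4⟩ := tauR_spec q hq
  obtain ⟨h1, h2, h3, h4⟩ := tensorTwist_apply q (irL q)
  obtain ⟨l1, l2, l3, l4⟩ := irL_apply q
  fin_cases i <;> fin_cases j
  · simp [h1, l1, l3, t3]
  · simp only [Fin.zero_eta, Fin.mk_one, h2, l1, l2, l3, l4, map_smul, t2,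
      TensorProduct.tmul_sub, TensorProduct.tmul_smul, pow_two (genF q), mul_assoc]
    match_scalars <;> field_simp
    ring
  · simp [h3, l3, t1]
  · simp only [Fin.mk_one, h4, l3, l4, map_sub, map_smul, t3, t4, TensorProduct.tmul_sub,
      TensorProduct.tmul_smul]
    match_scalars <;> field_simp

/-- In matrix form `Δ` and `τ_R` differ only by the left factor `L ⊗ 1`, so both kinds of extension
step fit the recursion `monodromyStep`. -/
theorem coprodR_irL (hs : (q : 𝕜) - (q : 𝕜)⁻¹ ≠ 0) (i j : Fin 2) :
    coprodR q (irL q i j) = (tensorL q (IR q) * tensorTwist q (irL q)) i j := by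
  have hq0 : (q : 𝕜) ≠ 0 := q.ne_zero
  have hs' : (q : 𝕜) ^ 2 - 1 ≠ 0 := fun h => hs (by rw [sub_inv_eq_div hq0, h, zero_div])
  -- `coprodR` is characterised by its image in `U ⊗ U`, so the entries are compared there.
  apply inclR_injective q
  rw [coprodR_spec]
  obtain ⟨h1, h2, h3, h4⟩ := tensorL_apply q (W := IR q)
  obtain ⟨t1, t2, t3, t4⟩ := tensorTwist_apply q (irL q)
  obtain ⟨l1, l2, l3, l4⟩ := irL_apply q
  have c1 : ((irKinv q : IR q) : Uq q) = genKinv q := rfl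
  have c2 : ((irE q : IR q) : Uq q) = genE q * genKinv q := rfl
  have c3 : ((irF q : IR q) : Uq q) = genF q := rfl
  have c4 : ((irCas q : IR q) : Uq q) = casimir q := rfl
  fin_cases i <;> fin_cases j <;>
  · simp only [Fin.zero_eta, Fin.mk_one, Matrix.mul_apply, Fin.sum_univ_two, h1, h2, h3, h4, t1,
      t2, t3, t4, l1, l2, l3, l4, c1, c2, c3, c4, map_add, map_sub, map_mul, map_smul, inclR_tmul,
      Subalgebra.coe_smul, Subalgebra.coe_sub, OneMemClass.coe_one, coprod_casimir, coprod_genE,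
      coprod_genF, coprod_genKinv]
    simp only [casimir, mul_add, add_mul, mul_sub, sub_mul, smul_mul_assoc, mul_smul_comm,
      mul_assoc, Algebra.TensorProduct.tmul_mul_tmul, mul_one, one_mul, smul_add, smul_sub,
      smul_smul, TensorProduct.tmul_add, TensorProduct.tmul_sub, TensorProduct.tmul_smul,
      TensorProduct.add_tmul, TensorProduct.sub_tmul, ← TensorProduct.smul_tmul',
      (isQuantumSl2_gen q).rules]
    match_scalars <;> field_simp <;> ring

/-- The composite of the first `s` morphisms of the right extension process for `A`, starting at
position `a`. -/
noncomputable def stageHom (hq : NotRootOfUnity q) (A : Finset ℕ) (a : ℕ) :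
    (s : ℕ) → IR q →ₐ[𝕜] tensorPowIR q s
  | 0 => AlgHom.id 𝕜 (IR q)
  | s + 1 => (onLast q (if a + s ∈ A then coprodR q else tauR q hq) s).comp (stageHom hq A a s)

theorem stageHom_irCas (hq : NotRootOfUnity q) (A : Finset ℕ) (a s : ℕ) :
    stageHom q hq A a s (irCas q) = extensionStage q hq A a s := by
  induction s with
  | zero => rfl
  | succ s ih => rw [extensionStage, ← ih]; rfl

/-- The process appends tensor factors at the right end, whereas `monodromy` recurses on the
leftmost factor. Splitting off the first morphism instead of the last reconciles the two. -/
theorem stageHom_succ (hq : NotRootOfUnity q) (A : Finset ℕ) (a s : ℕ) (x : IR q) :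
    stageHom q hq A a (s + 1) x =
      (Algebra.TensorProduct.map (AlgHom.id 𝕜 (Uq q)) (stageHom q hq A (a + 1) s))
        ((if a ∈ A then coprodR q else tauR q hq) x) := by
  induction s generalizing x with
  | zero =>
    change (if a + 0 ∈ A then coprodR q else tauR q hq) x =
      (Algebra.TensorProduct.map (AlgHom.id 𝕜 (Uq q)) (AlgHom.id 𝕜 (IR q))) _
    rw [Algebra.TensorProduct.map_id]
    rfl
  | succ s ih =>
    change onLast q (if a + (s + 1) ∈ A then coprodR q else tauR q hq) (s + 1)
      (stageHom q hq A a (s + 1) x) = _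
    rw [ih]
    change (Algebra.TensorProduct.map (AlgHom.id 𝕜 (Uq q))
      (onLast q (if a + (s + 1) ∈ A then coprodR q else tauR q hq) s))
      ((Algebra.TensorProduct.map (AlgHom.id 𝕜 (Uq q)) (stageHom q hq A (a + 1) s)) _) =
      (Algebra.TensorProduct.map (AlgHom.id 𝕜 (Uq q))
        ((onLast q (if a + 1 + s ∈ A then coprodR q else tauR q hq) s).comp
          (stageHom q hq A (a + 1) s))) _
    rw [show a + (s + 1) = a + 1 + s by ring, ← AlgHom.comp_apply,
      ← Algebra.TensorProduct.map_comp]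
    rfl

/-- The extension of a linear map from `I_R` to the second tensor factor maps the twist of the matrix
`L` to the twist of its image. -/
theorem map_tensorTwist {W W' : Type*} [Ring W] [Algebra 𝕜 W] [Ring W'] [Algebra 𝕜 W']
    (f : W →ₗ[𝕜] W') (M : Matrix (Fin 2) (Fin 2) W) (i j : Fin 2) :
    TensorProduct.map LinearMap.id f (tensorTwist q M i j) = tensorTwist q (M.map f) i j := by
  obtain ⟨h1, h2, h3, h4⟩ := tensorTwist_apply q M
  obtain ⟨l1, l2, l3, l4⟩ := tensorTwist_apply q (M.map f)
  fin_cases i <;> fin_cases j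
  · simp [h1, l1]
  · simp [h2, l2]
  · simp [h3, l3]
  · simp [h4, l4]

/-- `placeAt` is available only as a linear map. Multiplication by an element of the first factor
does not touch the factor on which `f` acts, so linearity is enough. -/
theorem map_tmul_one_mul {W W' : Type*} [Ring W] [Algebra 𝕜 W] [Ring W'] [Algebra 𝕜 W']
    (f : W →ₗ[𝕜] W') (x : Uq q) (y : Uq q ⊗[𝕜] W) :
    TensorProduct.map LinearMap.id f ((x ⊗ₜ 1) * y) =
      (x ⊗ₜ 1) * TensorProduct.map LinearMap.id f y := by
  induction y with
  | zero => simp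
  | tmul u v => simp
  | add y z hy hz => rw [mul_add, map_add, hy, hz, map_add, mul_add]

theorem map_tensorL_mul_tensorTwist {W W' : Type*} [Ring W] [Algebra 𝕜 W] [Ring W'] [Algebra 𝕜 W']
    (f : W →ₗ[𝕜] W') (M : Matrix (Fin 2) (Fin 2) W) (i j : Fin 2) :
    TensorProduct.map LinearMap.id f ((tensorL q W * tensorTwist q M) i j) =
      (tensorL q W' * tensorTwist q (M.map f)) i j := by
  simp only [Matrix.mul_apply, Fin.sum_univ_two, map_add, tensorL_eq, map_tmul_one_mul,
    map_tensorTwist]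

/-- The induction needs all entries of `L`, not just `Λ`, because one step of the process mixes
them. -/
theorem placeAt_stageHom (hq : NotRootOfUnity q) (A : Finset ℕ) (n a s : ℕ) (hs : s < n)
    (hmem : a + s ∈ A) (hmax : ∀ x ∈ A, x ≤ a + s) (i j : Fin 2) :
    placeAt q 0 s n (stageHom q hq A a s (irL q i j)) = monodromy q A n a i j := by
  induction n generalizing a s i j with
  | zero => exact absurd hs (Nat.not_lt_zero s)
  | succ n ih =>
    change _ = monodromyStep q (a ∈ A) (monodromy q A n (a + 1)) i j
    cases s with
    | zero =>
      -- At the maximum of `A` the remaining `I_R` factor itself supplies the last `L`; the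
      -- positions beyond contribute 1.
      rw [monodromyStep, if_pos (show a ∈ A from hmem), monodromy_eq_one fun x hx => Nat.lt_succ_of_le (hmax x hx),
        tensorTwist_one, mul_one, tensorL_eq]
      rfl
    | succ s =>
      have H : (irL q).map ((placeAt q 0 s n).comp (stageHom q hq A (a + 1) s).toLinearMap) =
          monodromy q A n (a + 1) := by
        ext i j
        exact ih (a + 1) s (by omega) (by rwa [add_right_comm, add_assoc])
          (fun x hx => by have := hmax x hx; omega) i j
      rw [stageHom_succ, monodromyStep]
      change TensorProduct.map LinearMap.id (placeAt q 0 s n)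
        (TensorProduct.map LinearMap.id (stageHom q hq A (a + 1) s).toLinearMap _) = _
      rw [← LinearMap.comp_apply, ← TensorProduct.map_comp, LinearMap.id_comp, ← H]
      split_ifs
      · rw [coprodR_irL q hq.sub_inv_ne_zero]
        exact map_tensorL_mul_tensorTwist q _ _ i j
      · rw [tauR_irL, one_mul]
        exact map_tensorTwist q _ _ i j

/-- At a position before the minimum of `A` the monodromy is merely conjugated. This leaves the
quantum trace unchanged up to `1 ⊗ ·`, which matches the padding by `placeAt`. -/
theorem placeAt_extensionStage (hq : NotRootOfUnity q) (A : Finset ℕ) (p n a s : ℕ)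
    (hs : p + s < n) (hmem : a + s ∈ A) (hmin : ∀ x ∈ A, a ≤ x) (hmax : ∀ x ∈ A, x ≤ a + s)
    (c : ℕ) (hc : c + p = a) :
    placeAt q p s n (extensionStage q hq A a s) = qTrace (q : 𝕜) (monodromy q A n c) := by
  induction p generalizing n c with
  | zero =>
    obtain rfl : c = a := hc
    rw [← stageHom_irCas, ← qTrace_irL, qTrace, map_add, map_smul, map_smul, map_add, map_smul,
      map_smul, placeAt_stageHom q hq A n c s (by omega) hmem hmax,
      placeAt_stageHom q hq A n c s (by omega) hmem hmax]
    rfl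
  | succ p ih =>
    cases n with
    | zero => exact absurd hs (Nat.not_lt_zero _)
    | succ n =>
      change (1 : Uq q) ⊗ₜ[𝕜] placeAt q p s n (extensionStage q hq A a s) =
        qTrace (q : 𝕜) (monodromyStep q (c ∈ A) (monodromy q A n (c + 1)))
      rw [ih n (by omega) (c + 1) (by omega), monodromyStep,
        if_neg fun hcA => by have := hmin c hcA; omega, one_mul, qTrace_tensorTwist]

theorem Lam_eq_qTrace (hq : NotRootOfUnity q) {n : ℕ} {A : Finset ℕ} (h1 : ∀ x ∈ A, 1 ≤ x)
    (h2 : ∀ x ∈ A, x ≤ n) : Lam q hq n A = qTrace (q : 𝕜) (monodromy q A n 1) := by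
  rw [Lam]
  split_ifs with h
  · have ha := h1 _ (A.min'_mem h)
    have hb := h2 _ (A.max'_mem h)
    have hab := A.min'_le_max' h
    rw [rightExtension]
    have e : A.min' h + (A.max' h - A.min' h) = A.max' h := by omega
    exact placeAt_extensionStage q hq A _ n _ _ (by omega) (by rw [e]; exact A.max'_mem h)
      (fun x hx => A.min'_le x hx) (fun x hx => by rw [e]; exact A.le_max' x hx) 1 (by omega)
  -- The convention `Λ_∅ = q + q⁻¹` is the quantum trace of the identity matrix.
  · rw [Finset.not_nonempty_iff_eq_empty.1 h, monodromy_eq_one (by simp)]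
    simp [qTrace, Algebra.algebraMap_eq_smul_one, add_smul]

end Extension

/-! ### From block decompositions to standard relations -/

section StandardRelations

universe u

variable {𝕜 : Type u} [Field 𝕜] {q : 𝕜ˣ}

/-- Four successive (possibly empty) blocks of `{1, …, n}`. -/
structure IsBlocks (n : ℕ) (A₁ A₂ A₃ A₄ : Finset ℕ) : Prop where
  lt₁₂ : ∀ x ∈ A₁, ∀ y ∈ A₂, x < y
  lt₁₃ : ∀ x ∈ A₁, ∀ y ∈ A₃, x < y
  lt₁₄ : ∀ x ∈ A₁, ∀ y ∈ A₄, x < y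
  lt₂₃ : ∀ x ∈ A₂, ∀ y ∈ A₃, x < y
  lt₂₄ : ∀ x ∈ A₂, ∀ y ∈ A₄, x < y
  lt₃₄ : ∀ x ∈ A₃, ∀ y ∈ A₄, x < y
  mem_Icc : ∀ x ∈ A₁ ∪ A₂ ∪ A₃ ∪ A₄, x ∈ Finset.Icc 1 n

theorem Lam_of_subset_Icc (hq : NotRootOfUnity q) {n : ℕ} {A : Finset ℕ}
    (h : ∀ x ∈ A, x ∈ Finset.Icc 1 n) :
    Lam q hq n A = qTrace (q : 𝕜) (monodromy q A n 1) :=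
  Lam_eq_qTrace q hq (fun x hx => (Finset.mem_Icc.1 (h x hx)).1)
    (fun x hx => (Finset.mem_Icc.1 (h x hx)).2)

variable {n : ℕ} {A₁ A₂ A₃ A₄ A B : Finset ℕ}

theorem IsBlocks.disjoint (h : IsBlocks n A₁ A₂ A₃ A₄) (x : ℕ) :
    (x ∈ A₁ → x ∉ A₂) ∧ (x ∈ A₁ → x ∉ A₃) ∧ (x ∈ A₁ → x ∉ A₄) ∧ (x ∈ A₂ → x ∉ A₃) ∧
      (x ∈ A₂ → x ∉ A₄) ∧ (x ∈ A₃ → x ∉ A₄) :=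
  ⟨fun h1 h2 => lt_irrefl x (h.lt₁₂ x h1 x h2), fun h1 h2 => lt_irrefl x (h.lt₁₃ x h1 x h2),
    fun h1 h2 => lt_irrefl x (h.lt₁₄ x h1 x h2), fun h1 h2 => lt_irrefl x (h.lt₂₃ x h1 x h2),
    fun h1 h2 => lt_irrefl x (h.lt₂₄ x h1 x h2), fun h1 h2 => lt_irrefl x (h.lt₃₄ x h1 x h2)⟩

theorem monodromy_union₃ (h12 : ∀ x ∈ A₁, ∀ y ∈ A₂, x < y) (h13 : ∀ x ∈ A₁, ∀ y ∈ A₃, x < y)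
    (h23 : ∀ x ∈ A₂, ∀ y ∈ A₃, x < y) (n a : ℕ) : monodromy q (A₁ ∪ A₂ ∪ A₃) n a =
      monodromy q A₁ n a * monodromy q A₂ n a * monodromy q A₃ n a := by
  rw [monodromy_union, monodromy_union h12]
  intro x hx y hy
  obtain hx | hx := Finset.mem_union.1 hx
  exacts [h13 x hx y hy, h23 x hx y hy]

theorem IsBlocks.monodromy_union (h : IsBlocks n A₁ A₂ A₃ A₄) (m a : ℕ) :
    monodromy q (A₁ ∪ A₂ ∪ A₃ ∪ A₄) m a =
      monodromy q A₁ m a * monodromy q A₂ m a * monodromy q A₃ m a * monodromy q A₄ m a := by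
  rw [AskeyWilson.monodromy_union, monodromy_union₃ h.lt₁₂ h.lt₁₃ h.lt₂₃]
  intro x hx y hy
  simp only [Finset.mem_union] at hx
  obtain (hx | hx) | hx := hx
  exacts [h.lt₁₄ x hx y hy, h.lt₂₄ x hx y hy, h.lt₃₄ x hx y hy]

theorem IsBlocks.Lam_eq (h : IsBlocks n A₁ A₂ A₃ A₄) (hq : NotRootOfUnity q) :
    letI M := fun A => monodromy q A n 1
    Lam q hq n (A₁ ∪ A₂ ∪ A₃ ∪ A₄) = qTrace (q : 𝕜) (M A₁ * M A₂ * M A₃ * M A₄) ∧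
    Lam q hq n (A₁ ∪ A₂ ∪ A₄) = qTrace (q : 𝕜) (M A₁ * M A₂ * M A₄) ∧
    Lam q hq n (A₁ ∪ A₃ ∪ A₄) = qTrace (q : 𝕜) (M A₁ * M A₃ * M A₄) ∧
    Lam q hq n (A₂ ∪ A₃) = qTrace (q : 𝕜) (M A₂ * M A₃) ∧
    Lam q hq n (A₁ ∪ A₄) = qTrace (q : 𝕜) (M A₁ * M A₄) ∧
    Lam q hq n A₂ = qTrace (q : 𝕜) (M A₂) ∧ Lam q hq n A₃ = qTrace (q : 𝕜) (M A₃) := by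
  have hm := h.mem_Icc
  refine ⟨?_, ?_, ?_, ?_, ?_, ?_, ?_⟩ <;>
    rw [Lam_of_subset_Icc hq fun x hx => hm x (by grind)]
  · rw [h.monodromy_union]
  · rw [monodromy_union₃ h.lt₁₂ h.lt₁₄ h.lt₂₄]
  · rw [monodromy_union₃ h.lt₁₃ h.lt₁₄ h.lt₃₄]
  · rw [AskeyWilson.monodromy_union h.lt₂₃]
  · rw [AskeyWilson.monodromy_union h.lt₁₄]

theorem IsBlocks.standardRelation_shared_second (h : IsBlocks n A₁ A₂ A₃ A₄)
    (hq : NotRootOfUnity q) (hA : A = A₁ ∪ A₂ ∪ A₄) (hB : B = A₂ ∪ A₃) :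
    StandardRelation q hq n A B := by
  have hs := hq.sub_inv_ne_zero
  have hd := h.disjoint
  have e1 : (A ∪ B) \ (A ∩ B) = A₁ ∪ A₃ ∪ A₄ := by ext x; have := hd x; grind
  have e2 : A ∩ B = A₂ := by ext x; have := hd x; grind
  have e3 : A ∪ B = A₁ ∪ A₂ ∪ A₃ ∪ A₄ := by grind
  have e4 : A \ A₂ = A₁ ∪ A₄ := by ext x; have := hd x; grind
  have e5 : B \ A₂ = A₃ := by ext x; have := hd x; grind
  obtain ⟨l1, l2, l3, l4, l5, l6, l7⟩ := h.Lam_eq hq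
  rw [StandardRelation, e1, e2, e3, e4, e5, hA, hB, l1, l2, l3, l4, l5, l6, l7]
  exact qTrace_relation_shared_second q.ne_zero (isReflection_monodromy hs _ _ _)
    (isExchange_monodromy hs h.lt₁₂ _ _)
    (isExchange_monodromy hs h.lt₁₃ _ _)
    (isExchange_monodromy hs h.lt₂₃ _ _)
    (isExchange_monodromy hs h.lt₂₄ _ _)
    (isExchange_monodromy hs h.lt₃₄ _ _)

theorem IsBlocks.standardRelation_shared_third (h : IsBlocks n A₁ A₂ A₃ A₄)
    (hq : NotRootOfUnity q) (hA : A = A₂ ∪ A₃) (hB : B = A₁ ∪ A₃ ∪ A₄) :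
    StandardRelation q hq n A B := by
  have hs := hq.sub_inv_ne_zero
  have hd := h.disjoint
  have e1 : (A ∪ B) \ (A ∩ B) = A₁ ∪ A₂ ∪ A₄ := by ext x; have := hd x; grind
  have e2 : A ∩ B = A₃ := by ext x; have := hd x; grind
  have e3 : A ∪ B = A₁ ∪ A₂ ∪ A₃ ∪ A₄ := by grind
  have e4 : A \ A₃ = A₂ := by ext x; have := hd x; grind
  have e5 : B \ A₃ = A₁ ∪ A₄ := by ext x; have := hd x; grind
  obtain ⟨l1, l2, l3, l4, l5, l6, l7⟩ := h.Lam_eq hq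
  rw [StandardRelation, e1, e2, e3, e4, e5, hA, hB, l1, l2, l3, l4, l5, l6, l7]
  exact qTrace_relation_shared_third q.ne_zero (isReflection_monodromy hs _ _ _)
    (isExchange_monodromy hs h.lt₁₂ _ _)
    (isExchange_monodromy hs h.lt₁₃ _ _)
    (isExchange_monodromy hs h.lt₂₃ _ _)
    (isExchange_monodromy hs h.lt₂₄ _ _)
    (isExchange_monodromy hs h.lt₃₄ _ _)

theorem IsBlocks.standardRelation_shared_ends (h : IsBlocks n A₁ A₂ A₃ A₄)
    (hq : NotRootOfUnity q) (hA : A = A₁ ∪ A₃ ∪ A₄) (hB : B = A₁ ∪ A₂ ∪ A₄) :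
    StandardRelation q hq n A B := by
  have hs := hq.sub_inv_ne_zero
  have hd := h.disjoint
  have e1 : (A ∪ B) \ (A ∩ B) = A₂ ∪ A₃ := by ext x; have := hd x; grind
  have e2 : A ∩ B = A₁ ∪ A₄ := by ext x; have := hd x; grind
  have e3 : A ∪ B = A₁ ∪ A₂ ∪ A₃ ∪ A₄ := by grind
  have e4 : A \ (A₁ ∪ A₄) = A₃ := by ext x; have := hd x; grind
  have e5 : B \ (A₁ ∪ A₄) = A₂ := by ext x; have := hd x; grind
  obtain ⟨l1, l2, l3, l4, l5, l6, l7⟩ := h.Lam_eq hq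
  rw [StandardRelation, e1, e2, e3, e4, e5, hA, hB, l1, l2, l3, l4, l5, l6, l7]
  exact qTrace_relation_shared_ends q.ne_zero (isReflection_monodromy hs _ _ _)
    (isReflection_monodromy hs _ _ _) (isExchange_monodromy hs h.lt₁₂ _ _)
    (isExchange_monodromy hs h.lt₁₃ _ _)
    (isExchange_monodromy hs h.lt₁₄ _ _)
    (isExchange_monodromy hs h.lt₂₃ _ _)
    (isExchange_monodromy hs h.lt₂₄ _ _)
    (isExchange_monodromy hs h.lt₃₄ _ _)

end StandardRelations

/-! ### Block decompositions of the nine pairs -/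

theorem mem_stepTwo {a m x : ℕ} : x ∈ stepTwo a m ↔ ∃ i < m, a + 2 * i = x := by
  simp [stepTwo]

theorem bounds_of_mem_stepTwo {a m x : ℕ} (h : x ∈ stepTwo a m) : a ≤ x ∧ x + 2 ≤ a + 2 * m := by
  obtain ⟨i, hi, rfl⟩ := mem_stepTwo.1 h
  omega

theorem stepTwo_zero (a : ℕ) : stepTwo a 0 = ∅ := by simp [stepTwo]

theorem stepTwo_succ (a m : ℕ) : stepTwo a (m + 1) = {a} ∪ stepTwo (a + 2) m := by
  ext x
  simp only [mem_stepTwo, Finset.mem_union, Finset.mem_singleton]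
  constructor
  · rintro ⟨i, hi, rfl⟩
    cases i with
    | zero => simp
    | succ i => exact Or.inr ⟨i, by omega, by ring⟩
  · rintro (rfl | ⟨i, hi, rfl⟩)
    · exact ⟨0, by omega, rfl⟩
    · exact ⟨i + 1, by omega, by ring⟩

theorem isBlocks_empty_singleton {n : ℕ} (hn : 1 ≤ n) : IsBlocks n ∅ ∅ {1} ∅ := by
  constructor <;> simp [hn]

/-- The blocks `{1}`, `{a, a + 2, …}`, `{b, b + 2, …}`, `{N}`. -/
theorem isBlocks_stepTwo {n a b k m N : ℕ} (ha : 1 < a) (hb : 1 < b) (hab : a + 2 * k < b + 2)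
    (hak : a + 2 * k < N + 2) (hbN : b + 2 * m < N + 2) (hN1 : 1 < N) (hN : N ≤ n) :
    IsBlocks n {1} (stepTwo a k) (stepTwo b m) {N} := by
  constructor <;> grind [→ bounds_of_mem_stepTwo]

theorem IsBlocks.of_subset {n : ℕ} {A₁ A₂ A₃ A₄ B₁ B₂ B₃ B₄ : Finset ℕ}
    (h : IsBlocks n A₁ A₂ A₃ A₄) (h1 : B₁ ⊆ A₁) (h2 : B₂ ⊆ A₂) (h3 : B₃ ⊆ A₃) (h4 : B₄ ⊆ A₄) :
    IsBlocks n B₁ B₂ B₃ B₄ where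
  lt₁₂ x hx y hy := h.lt₁₂ x (h1 hx) y (h2 hy)
  lt₁₃ x hx y hy := h.lt₁₃ x (h1 hx) y (h3 hy)
  lt₁₄ x hx y hy := h.lt₁₄ x (h1 hx) y (h4 hy)
  lt₂₃ x hx y hy := h.lt₂₃ x (h2 hx) y (h3 hy)
  lt₂₄ x hx y hy := h.lt₂₄ x (h2 hx) y (h4 hy)
  lt₃₄ x hx y hy := h.lt₃₄ x (h3 hx) y (h4 hy)
  mem_Icc x hx := h.mem_Icc x (by
    simp only [Finset.mem_union] at hx ⊢
    obtain ((hx | hx) | hx) | hx := hx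
    exacts [Or.inl (Or.inl (Or.inl (h1 hx))), Or.inl (Or.inl (Or.inr (h2 hx))),
      Or.inl (Or.inr (h3 hx)), Or.inr (h4 hx)])

/-- The blocks `∅`, `∅`, `{1, 3, …}`, `{N}`. -/
theorem isBlocks_odd {n m N : ℕ} (hm : 2 * m < N + 1) (hN1 : 1 < N) (hN : N ≤ n) :
    IsBlocks n ∅ ∅ (stepTwo 1 m) {N} := by
  constructor
  · simp
  · simp
  · simp
  · simp
  · simp
  · intro x hx y hy
    have := bounds_of_mem_stepTwo hx
    rw [Finset.mem_singleton] at hy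
    omega
  · intro x hx
    simp only [Finset.mem_union, Finset.mem_singleton, Finset.notMem_empty, false_or] at hx
    rw [Finset.mem_Icc]
    obtain hx | rfl := hx
    · have := bounds_of_mem_stepTwo hx
      omega
    · omega

end AskeyWilson

theorem proposition3p5 {𝕜 : Type*} [Field 𝕜] (q : 𝕜ˣ) (hq : NotRootOfUnity q) (k l n : ℕ) :
    (2 * k + 1 ≤ n → StandardRelation q hq n
      ({1} ∪ stepTwo 2 k)
      (stepTwo 2 k ∪ {2 * k + 1})) ∧
    (2 * k + 1 ≤ n → StandardRelation q hq n
      (stepTwo 2 k ∪ {2 * k + 1})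
      {1, 2 * k + 1}) ∧
    (2 * k + 1 ≤ n → StandardRelation q hq n
      {1, 2 * k + 1}
      ({1} ∪ stepTwo 2 k)) ∧
    (2 * k + 2 * l + 2 ≤ n → StandardRelation q hq n
      ({1} ∪ stepTwo 2 k ∪ {2 * k + 2 * l + 2})
      (stepTwo 2 k ∪ stepTwo (2 * k + 1) (l + 1))) ∧
    (2 * k + 2 * l + 3 ≤ n → StandardRelation q hq n
      ({1} ∪ stepTwo 2 k ∪ {2 * k + 2 * l + 3})
      (stepTwo 2 k ∪ stepTwo (2 * k + 2) (l + 1))) ∧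
    (2 * k + 2 * l + 2 ≤ n → StandardRelation q hq n
      (stepTwo 2 k ∪ stepTwo (2 * k + 1) (l + 1))
      ({1} ∪ stepTwo (2 * k + 1) (l + 1) ∪ {2 * k + 2 * l + 2})) ∧
    (2 * k + 2 * l + 3 ≤ n → StandardRelation q hq n
      (stepTwo 2 k ∪ stepTwo (2 * k + 2) (l + 1))
      ({1} ∪ stepTwo (2 * k + 2) (l + 1) ∪ {2 * k + 2 * l + 3})) ∧
    (2 * k + 2 * l + 2 ≤ n → StandardRelation q hq n
      ({1} ∪ stepTwo (2 * k + 1) (l + 1) ∪ {2 * k + 2 * l + 2})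
      ({1} ∪ stepTwo 2 k ∪ {2 * k + 2 * l + 2})) ∧
    (2 * k + 2 * l + 3 ≤ n → StandardRelation q hq n
      ({1} ∪ stepTwo (2 * k + 2) (l + 1) ∪ {2 * k + 2 * l + 3})
      ({1} ∪ stepTwo 2 k ∪ {2 * k + 2 * l + 3})) := by
  have even : 2 * k + 2 * l + 3 ≤ n →
      IsBlocks n {1} (stepTwo 2 k) (stepTwo (2 * k + 2) (l + 1)) {2 * k + 2 * l + 3} := fun hn =>
    isBlocks_stepTwo (by omega) (by omega) (by omega) (by omega) (by omega) (by omega) hn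
  -- For `k = 0` the position `2k + 1` coincides with `1`, so in the unprimed cases the generic
  -- blocks are no longer disjoint and others must be chosen. The primed cases are unaffected.
  obtain rfl | hk := Nat.eq_zero_or_pos k
  · have odd : 2 * 0 + 2 * l + 2 ≤ n →
        IsBlocks n {1} ∅ (stepTwo (2 * 0 + 1 + 2) l) {2 * 0 + 2 * l + 2} := fun hn =>
      (isBlocks_stepTwo (a := 2) (k := 0) (by omega) (by omega) (by omega) (by omega) (by omega)
        (by omega) hn).of_subset subset_rfl (Finset.empty_subset _) subset_rfl subset_rfl
    refine ⟨fun hn => ?_, fun hn => ?_, fun hn => ?_, fun hn => ?_,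
      fun hn => (even hn).standardRelation_shared_second hq rfl rfl, fun hn => ?_,
      fun hn => (even hn).standardRelation_shared_third hq rfl rfl, fun hn => ?_,
      fun hn => (even hn).standardRelation_shared_ends hq rfl rfl⟩
    -- In the first three cases both sets are now `{1}`, which is taken as the third block, the
    -- others being empty.
    · exact (isBlocks_empty_singleton hn).standardRelation_shared_third hq
        (by simp [stepTwo_zero]) (by simp [stepTwo_zero])
    · exact (isBlocks_empty_singleton hn).standardRelation_shared_third hq
        (by simp [stepTwo_zero]) (by simp)
    · exact (isBlocks_empty_singleton hn).standardRelation_shared_third hq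
        (by simp) (by simp [stepTwo_zero])
    -- Here the sets are `{1, 2l+2}` and `{1, 3, …, 2l+1}`. They share only the first block, so the
    -- shape with shared outer blocks applies with an empty fourth block.
    · have h : IsBlocks n {1} (stepTwo (2 * 0 + 1 + 2) l) {2 * 0 + 2 * l + 2} ∅ :=
        ⟨(odd hn).lt₁₃, (odd hn).lt₁₄, by simp, (odd hn).lt₃₄, by simp, by simp, fun x hx =>
          (odd hn).mem_Icc x (by simpa using hx)⟩
      exact h.standardRelation_shared_ends hq (by simp [stepTwo_zero])
        (by simp [stepTwo_zero, stepTwo_succ])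
    · exact (isBlocks_odd (m := l + 1) (by omega) (by omega) hn).standardRelation_shared_third hq
        (by simp [stepTwo_zero]) (by simp [stepTwo_succ])
    · exact (odd hn).standardRelation_shared_ends hq (by simp [stepTwo_succ])
        (by simp [stepTwo_zero])
  · have three : 2 * k + 1 ≤ n → IsBlocks n {1} (stepTwo 2 k) {2 * k + 1} ∅ := fun hn =>
      -- The end point `2k + 2` is auxiliary and may exceed `n`, hence `n + 1`. It is then discarded
      -- and the bound by `n` is proved again.
      (isBlocks_stepTwo (b := 2 * k + 1) (m := 1) (N := 2 * k + 2) (n := n + 1) (by omega)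
        (by omega) (by omega) (by omega) (by omega) (by omega) (by omega)).of_subset
        subset_rfl subset_rfl (by simp [stepTwo]) (Finset.empty_subset _) |> fun h =>
        ⟨h.lt₁₂, h.lt₁₃, h.lt₁₄, h.lt₂₃, h.lt₂₄, h.lt₃₄, fun x hx => by
          have h1 := Finset.mem_Icc.1 (h.mem_Icc x hx)
          simp only [Finset.mem_union, Finset.mem_singleton, Finset.notMem_empty, or_false] at hx
          rw [Finset.mem_Icc]
          obtain (rfl | hx) | rfl := hx
          · omega
          · have := bounds_of_mem_stepTwo hx
            omega
          · omega⟩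
    have odd : 2 * k + 2 * l + 2 ≤ n →
        IsBlocks n {1} (stepTwo 2 k) (stepTwo (2 * k + 1) (l + 1)) {2 * k + 2 * l + 2} :=
      fun hn =>
        isBlocks_stepTwo (by omega) (by omega) (by omega) (by omega) (by omega) (by omega) hn
    exact ⟨fun hn => (three hn).standardRelation_shared_second hq (by simp) rfl,
      fun hn => (three hn).standardRelation_shared_third hq rfl (by simp),
      fun hn => (three hn).standardRelation_shared_ends hq (by simp) (by simp),
      fun hn => (odd hn).standardRelation_shared_second hq rfl rfl,
      fun hn => (even hn).standardRelation_shared_second hq rfl rfl,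
      fun hn => (odd hn).standardRelation_shared_third hq rfl rfl,
      fun hn => (even hn).standardRelation_shared_third hq rfl rfl,
      fun hn => (odd hn).standardRelation_shared_ends hq rfl rfl,
      fun hn => (even hn).standardRelation_shared_ends hq rfl rfl⟩
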